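/- **Lemma (Gapped-Relevant-Input is contained in $\mathsf{NP}^{\mathsf{BPP}}$).** Let $\Phi\colon\{0,1\}^d\to\{0,1\}$ and $\mathbf{x}\in\{0,1\}^d$. For a real number $\delta$, a set $S\subseteq\{1,\dots,d\}$ is called *$\delta$-relevant* for $\Phi$ and $\mathbf{x}$ if $P_{\mathbf{y}}\big(\Phi(\mathbf{y})=\Phi(\mathbf{x})\,\big|\,\mathbf{y}_S=\mathbf{x}_S\big)\ge\delta$, where $\mathbf{y}$ is uniformly distributed on $\{0,1\}^d$. For $\delta\in(0,1)$ and $\gamma\in(0,\delta)$, *Gapped-Relevant-Input* is the following promise problem. An instance consists of a Boolean function $\Phi\colon\{0,1\}^d\to\{0,1\}$, given as a logical expression built from AND, OR and NOT, a vector $\mathbf{x}\in\{0,1\}^d$, and an integer $k$ with $1\le k\le d$. It is a *Yes*-instance if some $S\subseteq\{1,\dots,d\}$ with $|S|\le k$ is $\delta$-relevant for $\Phi$ and $\mathbf{x}$, and a *No*-instance if no $S\subseteq\{1,\dots,d\}$ with $|S|\le k$ is $(\delta-\gamma)$-relevant for $\Phi$ and $\mathbf{x}$. Here $\mathsf{BPP}$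 is the class of promise problems for which a probabilistic polynomial-time Turing machine accepts every Yes-instance with probability at least $2/3$ and every No-instance with probability at most $1/3$. A promise problem belongs to $\mathsf{NP}^{\mathsf{BPP}}$ if there are a promise problem $Q\in\mathsf{BPP}$ and a nondeterministic polynomial-time oracle Turing machine which, for every oracle language that contains all Yes-instances and no No-instance of $Q$, has an accepting computation on every Yes-instance of the given problem and no accepting computation on any No-instance of it. Then, for all real $\delta\in(0,1)$ and $\gamma\in(0,\delta)$: 1. Gapped-Relevant-Input belongs to $\mathsf{NP}^{\mathsf{BPP}}$. 2. Moreover, a given set $S$ can be tested with $n=\lceil 2\ln 3/\gamma^2\rceil$ samples: for all $d$, $\Phi\colon\{0,1\}^d\to\{0,1\}$, $\mathbf{x}\in\{0,1\}^d$ and $S\subseteq\{1,\dots,d\}$, let $\mathbf{y}^{(1)},\dots,\mathbf{y}^{(n)}$ be independent random vectors that agree with $\mathbf{x}$ on $S$ and are uniformly distributed off $S$, and let $\xi$ be the fraction of the $i$ with $\Phi(\mathbf{y}^{(i)})=\Phi(\mathbf{x})$. If $S$ is $\delta$-relevant, then $\xi\ge\delta-\gamma/2$ with probability at least $2/3$;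 if $S$ is not $(\delta-\gamma)$-relevant, then $\xi<\delta-\gamma/2$ with probability at least $2/3$. -/

import Mathlib

/-! ### Uniform probabilities on finite types -/

open Classical in
/-- The probability of `E` under the uniform distribution on the finite type `α`. -/
noncomputable def unifProb {α : Type} [Fintype α] (E : α → Prop) : ℝ :=
  ((Finset.univ.filter E).card : ℝ) / (Fintype.card α : ℝ)

open Classical in
/-- The conditional probability `P(E | F)` under the uniform distribution on `α`. -/
noncomputable def unifCondProb {α : Type} [Fintype α] (E F : α → Prop) : ℝ :=
  ((Finset.univ.filter fun a => E a ∧ F a).card : ℝ) / ((Finset.univ.filter F).card : ℝ)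

/-! ### Promise problems -/

/-- A promise problem over binary words: disjoint sets of Yes- and No-instances. -/
structure PromiseProblem where
  yes : Language Bool
  no : Language Bool
  disj : ∀ w, w ∈ yes → w ∉ no

/-- The language `A` solves the promise problem `Q`: it contains all Yes-instances and no
No-instance, and is arbitrary on words that violate the promise. -/
def PromiseProblem.SolvedBy (Q : PromiseProblem) (A : Language Bool) : Prop :=
  (∀ w ∈ Q.yes, w ∈ A) ∧ (∀ w ∈ Q.no, w ∉ A)

/-! ### Nondeterministic / probabilistic oracle machines -/

/-- A multi-stack Turing machine (in the sense of Mathlib's `Turing.TM2`) with finitely many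
stacks, labels, internal states and stack symbols, with two transition functions
`prog false` and `prog true` and with oracle access. In every step a choice bit (a
nondeterministic choice or a fair coin) selects the transition function. A label `l` with
`ask l = some (y, n)` is a query label: the word on the query stack is handed to the oracle,
the query stack is emptied, and the machine goes on at `y` or `n` according to the answer.
When the machine has halted, its internal state tells whether it accepts. -/
structure ChoiceMachine where
  K : Type
  [decEqK : DecidableEq K]
  [finK : Fintype K]
  Γ : K → Type
  [finΓ : ∀ k, Fintype (Γ k)]
  Λ : Type
  [finΛ : Fintype Λ]
  σ : Type
  [finσ : Fintype σ]
  /-- the stack that holds the input word at the start, first letter on top -/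
  inStack : K
  /-- the stack whose content, read from the top, is the query word -/
  queryStack : K
  inBit : Γ inStack ≃ Bool
  queryBit : Γ queryStack ≃ Bool
  main : Λ
  start : σ
  prog : Bool → Λ → Turing.TM2.Stmt Γ Λ σ
  ask : Λ → Option (Λ × Λ)
  accepting : σ → Bool

namespace ChoiceMachine

attribute [instance] decEqK finK finΓ finΛ finσ

/-- Configurations: the current label (`none` if halted), the internal state, the stacks. -/
abbrev Cfg (M : ChoiceMachine) : Type := Turing.TM2.Cfg M.Γ M.Λ M.σ

/-- The initial configuration on input `w`: all stacks but the input stack are empty. -/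
def initCfg (M : ChoiceMachine) (w : List Bool) : M.Cfg where
  l := some M.main
  var := M.start
  stk := Function.update (fun _ => []) M.inStack (w.map M.inBit.symm)

open Classical in
/-- One step with oracle `A` and choice bit `b`. A halted configuration does not change. -/
noncomputable def step (M : ChoiceMachine) (A : Language Bool) (c : M.Cfg) (b : Bool) : M.Cfg :=
  match c.l.bind M.ask with
  | some (y, n) =>
      { l := some (if (c.stk M.queryStack).map M.queryBit ∈ A then y else n)
        var := c.var
        stk := Function.update c.stk M.queryStack [] }
  | none => (Turing.TM2.step (M.prog b) c).getD c

/-- The configuration reached on input `w` with oracle `A` after `r.length` steps in which the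
choice bits are the entries of `r`. -/
noncomputable def run (M : ChoiceMachine) (A : Language Bool) (w r : List Bool) : M.Cfg :=
  r.foldl (M.step A) (M.initCfg w)

/-- Along the choices `r`, the machine halts on input `w` in an accepting state. -/
def Accepts (M : ChoiceMachine) (A : Language Bool) (w r : List Bool) : Prop :=
  (M.run A w r).l = none ∧ M.accepting (M.run A w r).var = true

/-- For every oracle, every input `w` and all choices, the machine halts within `p |w|` steps. -/
def RunsInTime (M : ChoiceMachine) (p : Polynomial ℕ) : Prop :=
  ∀ (A : Language Bool) (w r : List Bool), r.length = p.eval w.length → (M.run A w r).l = none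

/-- The machine has no query labels, i.e. it is an ordinary machine without oracle. -/
def QueryFree (M : ChoiceMachine) : Prop :=
  ∀ l, M.ask l = none

end ChoiceMachine

/-! ### Complexity classes of promise problems -/

/-- The class `BPP` (of promise problems): there is a probabilistic polynomial-time machine
without oracle that accepts Yes-instances with probability at least `2/3` and No-instances with
probability at most `1/3`. (As there are no queries, the oracle plays no role; `0` is the empty
language.) -/
def BPP : Set PromiseProblem :=
  {Q | ∃ (M : ChoiceMachine) (p : Polynomial ℕ), M.QueryFree ∧ M.RunsInTime p ∧
    (∀ w ∈ Q.yes, 2 / 3 ≤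
      unifProb fun r : Fin (p.eval w.length) → Bool => M.Accepts 0 w (List.ofFn r)) ∧
    (∀ w ∈ Q.no,
      unifProb (fun r : Fin (p.eval w.length) → Bool => M.Accepts 0 w (List.ofFn r)) ≤ 1 / 3)}

/-- The class `NP^C` (of promise problems) for a class `C` of promise problems: for some `Q ∈ C`
there is a nondeterministic polynomial-time oracle machine that, with any oracle that solves `Q`,
has an accepting computation on every Yes-instance and none on any No-instance. -/
def NPRel (C : Set PromiseProblem) : Set PromiseProblem :=
  {P | ∃ Q ∈ C, ∃ (M : ChoiceMachine) (p : Polynomial ℕ), M.RunsInTime p ∧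
    ∀ A : Language Bool, Q.SolvedBy A →
      (∀ w ∈ P.yes, ∃ r : List Bool, r.length = p.eval w.length ∧ M.Accepts A w r) ∧
      (∀ w ∈ P.no, ¬ ∃ r : List Bool, r.length = p.eval w.length ∧ M.Accepts A w r)}

/-! ### Boolean formulas and their description -/

/-- Logical expressions in the variables `0, …, d - 1`, built with NOT, AND and OR. -/
inductive BoolFormula (d : ℕ) : Type
  | var (i : Fin d)
  | neg (φ : BoolFormula d)
  | conj (φ ψ : BoolFormula d)
  | disj (φ ψ : BoolFormula d)

/-- The symbols of which a logical expression consists. -/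
inductive FormulaToken (d : ℕ) : Type
  | var (i : Fin d)
  | neg
  | conj
  | disj

namespace BoolFormula

variable {d : ℕ}

/-- The Boolean function described by the expression. -/
def eval : BoolFormula d → (Fin d → Bool) → Bool
  | var i, y => y i
  | neg φ, y => !(φ.eval y)
  | conj φ ψ, y => φ.eval y && ψ.eval y
  | disj φ ψ, y => φ.eval y || ψ.eval y

/-- The expression in reverse Polish order (each operator after its operands). -/
def tokens : BoolFormula d → List (FormulaToken d)
  | var i => [.var i]
  | neg φ => φ.tokens ++ [.neg]
  | conj φ ψ => φ.tokens ++ ψ.tokens ++ [.conj]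
  | disj φ ψ => φ.tokens ++ ψ.tokens ++ [.disj]

end BoolFormula

/-- A binary code of the symbols in which no code word begins another. Variable indices are
written in unary. As an instance of the problem below also contains a vector of length `d`, this
changes the length of instances only polynomially, compared with binary indices. -/
def FormulaToken.bits {d : ℕ} : FormulaToken d → List Bool
  | .var i => false :: (List.replicate i true ++ [false])
  | .neg => [true, false]
  | .conj => [true, true, false]
  | .disj => [true, true, true]

/-- The binary description of a logical expression. -/
def BoolFormula.encode {d : ℕ} (φ : BoolFormula d) : List Bool :=
  φ.tokens.flatMap FormulaToken.bits

/-! ### Relevant sets and the gapped problem -/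

/-- `S` is `δ`-relevant for `Φ` and `x`: `P_y (Φ y = Φ x | y_S = x_S) ≥ δ`. -/
def IsRelevant {d : ℕ} (δ : ℝ) (Φ : (Fin d → Bool) → Bool) (x : Fin d → Bool)
    (S : Finset (Fin d)) : Prop :=
  δ ≤ unifCondProb (fun y => Φ y = Φ x) (fun y => ∀ i ∈ S, y i = x i)

/-- An instance `(Φ, x, k)` with `1 ≤ k ≤ d`. -/
structure RelevantInputInstance where
  d : ℕ
  Φ : BoolFormula d
  x : Fin d → Bool
  k : ℕ
  one_le_k : 1 ≤ k
  k_le_d : k ≤ d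

namespace RelevantInputInstance

/-- The binary description of an instance: `k` in unary (note `k ≤ d`), then the vector `x` with
every entry preceded by a continuation bit, then the logical expression `Φ`. -/
def encode (I : RelevantInputInstance) : List Bool :=
  (List.replicate I.k true ++ [false]) ++
    (((List.ofFn I.x).flatMap fun b => [true, b]) ++ [false]) ++ I.Φ.encode

/-- Some set of at most `k` variables is `δ`-relevant. -/
def HasRelevantSet (I : RelevantInputInstance) (δ : ℝ) : Prop :=
  ∃ S : Finset (Fin I.d), S.card ≤ I.k ∧ IsRelevant δ I.Φ.eval I.x S

end RelevantInputInstance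

/-! ### The description determines the instance -/

/-- Reads symbols in reverse Polish order with a stack of expressions. -/
def FormulaToken.parse {d : ℕ} : List (FormulaToken d) → List (BoolFormula d) → List (BoolFormula d)
  | [], st => st
  | .var i :: ts, st => parse ts (.var i :: st)
  | .neg :: ts, φ :: st => parse ts (.neg φ :: st)
  | .conj :: ts, ψ :: φ :: st => parse ts (.conj φ ψ :: st)
  | .disj :: ts, ψ :: φ :: st => parse ts (.disj φ ψ :: st)
  | _, _ => []

theorem FormulaToken.parse_tokens {d : ℕ} (φ : BoolFormula d) :
    ∀ (ts : List (FormulaToken d)) (st : List (BoolFormula d)),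
      parse (φ.tokens ++ ts) st = parse ts (φ :: st) := by
  induction φ with
  | var i => intro ts st; simp [BoolFormula.tokens, parse]
  | neg φ ih => intro ts st; simp [BoolFormula.tokens, ih, parse]
  | conj φ ψ ih₁ ih₂ => intro ts st; simp [BoolFormula.tokens, ih₁, ih₂, parse]
  | disj φ ψ ih₁ ih₂ => intro ts st; simp [BoolFormula.tokens, ih₁, ih₂, parse]

theorem BoolFormula.tokens_injective {d : ℕ} :
    Function.Injective (BoolFormula.tokens (d := d)) := by
  intro φ ψ h
  have h₁ := FormulaToken.parse_tokens φ [] []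
  rw [h, FormulaToken.parse_tokens ψ [] []] at h₁
  simpa [FormulaToken.parse] using h₁.symm

theorem unary_append_inj : ∀ {m n : ℕ} {u v : List Bool},
    List.replicate m true ++ false :: u = List.replicate n true ++ false :: v → m = n ∧ u = v
  | 0, 0, _, _, h => by simpa using h
  | 0, n + 1, _, _, h => by simp [List.replicate_succ] at h
  | m + 1, 0, _, _, h => by simp [List.replicate_succ] at h
  | m + 1, n + 1, u, v, h => by
      have h₁ := @unary_append_inj m n u v (by simpa [List.replicate_succ] using h)
      exact ⟨by rw [h₁.1], h₁.2⟩

theorem FormulaToken.bits_append_inj {d : ℕ} {s t : FormulaToken d} {u v : List Bool}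
    (h : s.bits ++ u = t.bits ++ v) : s = t ∧ u = v := by
  cases s <;> cases t <;> simp [FormulaToken.bits] at h ⊢
  case var.var i j =>
    have h₁ := unary_append_inj h
    exact ⟨Fin.ext h₁.1, h₁.2⟩
  all_goals exact h

theorem FormulaToken.flatMap_bits_injective {d : ℕ} :
    ∀ {s t : List (FormulaToken d)}, s.flatMap bits = t.flatMap bits → s = t
  | [], [], _ => rfl
  | [], t :: _, h => by cases t <;> simp [bits] at h
  | s :: _, [], h => by cases s <;> simp [bits] at h
  | s :: ss, t :: ts, h => by
      have h₁ := bits_append_inj (s := s) (t := t) (by simpa [List.flatMap_cons] using h)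
      rw [h₁.1, flatMap_bits_injective h₁.2]

theorem BoolFormula.encode_injective {d : ℕ} :
    Function.Injective (BoolFormula.encode (d := d)) :=
  fun _ _ h => BoolFormula.tokens_injective (FormulaToken.flatMap_bits_injective h)

theorem continued_append_inj : ∀ {x y u v : List Bool},
    (x.flatMap fun b => [true, b]) ++ false :: u = (y.flatMap fun b => [true, b]) ++ false :: v →
      x = y ∧ u = v
  | [], [], _, _, h => by simpa using h
  | [], _ :: _, _, _, h => by simp at h
  | _ :: _, [], _, _, h => by simp at h
  | a :: x, b :: y, u, v, h => by
      simp only [List.flatMap_cons, List.cons_append, List.nil_append, List.cons.injEq,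
        true_and] at h
      have h₁ := continued_append_inj h.2
      exact ⟨by rw [h.1, h₁.1], h₁.2⟩

theorem RelevantInputInstance.encode_injective :
    Function.Injective RelevantInputInstance.encode := by
  rintro ⟨d, Φ, x, k, h₁, h₂⟩ ⟨d', Φ', x', k', h₁', h₂'⟩ h
  simp only [RelevantInputInstance.encode, List.append_assoc, List.cons_append,
    List.nil_append] at h
  obtain ⟨rfl, h'⟩ := unary_append_inj h
  obtain ⟨hx, hΦ⟩ := continued_append_inj h'
  obtain rfl : d = d' := by simpa using congrArg List.length hx
  obtain rfl := List.ofFn_injective hx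
  obtain rfl := BoolFormula.encode_injective hΦ
  rfl

/-- The promise problem `Gapped-Relevant-Input`. Yes: some set of at most `k` variables is
`δ`-relevant. No: no set of at most `k` variables is `(δ - γ)`-relevant. -/
def GappedRelevantInput (δ γ : ℝ) (hγ : 0 ≤ γ) : PromiseProblem where
  yes := {w | ∃ I : RelevantInputInstance, I.encode = w ∧ I.HasRelevantSet δ}
  no := {w | ∃ I : RelevantInputInstance, I.encode = w ∧ ¬ I.HasRelevantSet (δ - γ)}
  disj := by
    rintro w ⟨I, rfl, S, hS, hrel⟩ ⟨J, hJ, hno⟩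
    obtain rfl := RelevantInputInstance.encode_injective hJ
    exact hno ⟨S, hS, le_trans (sub_le_self δ hγ) hrel⟩

/-! ### The sampling test -/

/-- The vector that agrees with `x` on `S` and with `b` off `S`. -/
def completion {d : ℕ} (x : Fin d → Bool) (S : Finset (Fin d)) (b : {i // i ∉ S} → Bool) :
    Fin d → Bool :=
  fun i => if h : i ∈ S then x i else b ⟨i, h⟩

/-- The fraction of the `n` completions given by `b` that leave the value `Φ x` unchanged. -/
noncomputable def sampleMean {d n : ℕ} (Φ : (Fin d → Bool) → Bool) (x : Fin d → Bool)
    (S : Finset (Fin d)) (b : Fin n → {i // i ∉ S} → Bool) : ℝ :=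
  ((Finset.univ.filter fun i => Φ (completion x S (b i)) = Φ x).card : ℝ) / (n : ℝ)

/-! ### Uniform probabilities -/

/-! The proof is guess and check. The nondeterministic machine `guesser` guesses a set `S` by
attaching one bit to every letter of the input, then makes a single query with the annotated word.
The probabilistic machine `sampler` checks `|S| ≤ k` and estimates the relevance of `S` by sampling.
The problem `Q` behind the oracle is `sampler.problem`: its Yes- and No-instances are by definition
the words that `sampler` accepts with probability at least 2/3, respectively at most 1/3. Hence `Q ∈
BPP` needs only the running time, and the content lies in showing that annotated instances fall on
the right side. A set whose relevance lies inside the gap may violate the promise of `Q`. This is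
harmless: a Yes-instance needs one good annotation, and on a No-instance every annotation leads to a
No-instance of `Q` (`mem_NPRel_of_annotation`).

The acceptance threshold `δ - γ / 2` is the middle of the gap, so an error means that the empirical
mean deviates by at least `γ / 2`. Hoeffding's inequality (`hoeffding_unifProb`) bounds this
probability by `exp (-n γ² / 2) ≤ 1 / 3`.

As `γ` is fixed, the number `N + 1` of samples is a constant. So one stack symbol can hold the
values at `x` and at all samples, and a single pass over the reverse Polish expression evaluates all
of them. `sampler.accepts_iff` identifies acceptance with the sampling test, and
`sampler.unifProb_samples` shows that the samples read off from the choice bits are uniform, because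
they use pairwise different choice bits. -/

theorem unifProb_congr {α : Type} [Fintype α] {E F : α → Prop} (h : ∀ a, E a ↔ F a) :
    unifProb E = unifProb F := by
  rw [funext fun a => propext (h a)]

theorem unifProb_false {α : Type} [Fintype α] : unifProb (fun _ : α => False) = 0 := by
  simp [unifProb]

theorem unifProb_not {α : Type} [Fintype α] [Nonempty α] (E : α → Prop) :
    unifProb (fun a => ¬ E a) = 1 - unifProb E := by
  classical
  have h := Finset.card_filter_add_card_filter_not (s := (Finset.univ : Finset α)) E
  have h0 : (Fintype.card α : ℝ) ≠ 0 := by exact_mod_cast Fintype.card_ne_zero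
  rw [Finset.card_univ] at h
  unfold unifProb
  rw [eq_sub_iff_add_eq, ← add_div, div_eq_one_iff_eq h0, add_comm]
  convert (by exact_mod_cast h : (((Finset.univ.filter E).card : ℝ) +
    ((Finset.univ.filter fun a => ¬ E a).card : ℝ)) = Fintype.card α)

theorem unifProb_mono {α : Type} [Fintype α] {E F : α → Prop} (h : ∀ a, E a → F a) :
    unifProb E ≤ unifProb F := by
  classical
  unfold unifProb
  gcongr with a
  exact h a

/-- The uniform distribution is invariant under bijections. -/
theorem unifProb_comp_equiv {α β : Type} [Fintype α] [Fintype β] (e : α ≃ β) (E : β → Prop) :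
    unifProb (fun a => E (e a)) = unifProb E := by
  classical
  unfold unifProb
  rw [Fintype.card_congr e]
  congr 2
  refine Finset.card_bij (fun a _ => e a) (by simp) (fun _ _ _ _ h => e.injective h) ?_
  intro b hb
  exact ⟨e.symm b, by simpa using hb, by simp⟩

theorem unifProb_fst {α β : Type} [Fintype α] [Fintype β] [Nonempty β] (E : α → Prop) :
    unifProb (fun p : α × β => E p.1) = unifProb E := by
  classical
  have h0 : (Fintype.card β : ℝ) ≠ 0 := by exact_mod_cast Fintype.card_ne_zero
  have h : (Finset.univ.filter fun p : α × β => E p.1) = (Finset.univ.filter E) ×ˢ Finset.univ := by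
    ext p; simp
  have h' : (Finset.univ.filter fun p : α × β => E p.1).card
      = (Finset.univ.filter E).card * Fintype.card β := by
    rw [h, Finset.card_product, Finset.card_univ]
  unfold unifProb
  rw [Fintype.card_prod, ← mul_div_mul_right ((Finset.univ.filter E).card : ℝ) _ h0,
    ← Nat.cast_mul, ← Nat.cast_mul, ← h']

/-- The restriction of uniformly distributed bits to some of the coordinates is uniform. -/
theorem unifProb_comp_injective {ι κ : Type} [Fintype ι] [Fintype κ] [DecidableEq ι]
    [DecidableEq κ] (e : κ → ι) (he : Function.Injective e) (E : (κ → Bool) → Prop) :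
    unifProb (fun r : ι → Bool => E (r ∘ e)) = unifProb E := by
  classical
  -- Splitting the coordinates into the range of `e` and the rest makes the restriction a projection
  -- from a product.
  let f : (ι → Bool) ≃ (κ → Bool) × ({i // ¬ i ∈ Set.range e} → Bool) :=
    (Equiv.piEquivPiSubtypeProd (fun i => i ∈ Set.range e) fun _ => Bool).trans
      (Equiv.prodCongr (Equiv.arrowCongr (Equiv.ofInjective e he).symm (Equiv.refl _))
        (Equiv.refl _))
  rw [← unifProb_fst (β := {i // ¬ i ∈ Set.range e} → Bool) E, ← unifProb_comp_equiv f]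
  refine unifProb_congr fun r => ?_
  have : r ∘ e = (f r).1 := by
    funext k
    simp [f, Equiv.piEquivPiSubtypeProd]
  rw [this]

/-! ### Hoeffding's inequality for uniform samples -/

section Hoeffding

open MeasureTheory ProbabilityTheory

theorem unifProb_eq_measureReal {α : Type} [Fintype α] [MeasurableSpace α]
    [MeasurableSingletonClass α] (μ : Measure α) [IsFiniteMeasure μ]
    (h : ∀ a, μ.real {a} = (Fintype.card α : ℝ)⁻¹) (E : α → Prop) :
    unifProb E = μ.real {a | E a} := by
  classical
  have : {a | E a} = ((Finset.univ.filter E : Finset α) : Set α) := by ext; simp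
  rw [this, ← sum_measureReal_singleton, Finset.sum_congr rfl fun a _ => h a,
    Finset.sum_const, nsmul_eq_mul, unifProb, div_eq_mul_inv]

/-- Under the product of uniform measures the centred variables are independent, and by Hoeffding's
lemma each is sub-Gaussian with parameter `(1/2)^2`. The tail bound for their sum at `n * ε` is then
`exp (-(n ε)² / (2 n / 4))`. -/
theorem hoeffding_unifProb {α : Type} [Fintype α] [Nonempty α] (f : α → ℝ)
    (hf : ∀ a, f a ∈ Set.Icc (0 : ℝ) 1) (n : ℕ) (hn : 0 < n) (ε : ℝ) (hε : 0 ≤ ε) :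
    unifProb (fun b : Fin n → α =>
      (∑ a, f a) / Fintype.card α + ε ≤ (∑ i, f (b i)) / n) ≤ Real.exp (-(2 * n * ε ^ 2)) := by
  classical
  let _ : MeasurableSpace α := ⊤
  let ν : Measure α := uniformOn Set.univ
  have hν : ∀ a, ν.real {a} = (Fintype.card α : ℝ)⁻¹ := fun a => by
    simp [ν, Measure.real, uniformOn_univ]
  have hmeas : ∀ g : α → ℝ, Measurable g := fun g => measurable_from_top
  have hint : ∫ a, f a ∂ν = (∑ a, f a) / Fintype.card α := by
    rw [integral_fintype (Integrable.of_finite)]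
    simp [hν, div_eq_inv_mul, Finset.mul_sum]
  let μ : Measure (Fin n → α) := Measure.pi fun _ => ν
  have hμ : ∀ b, μ.real {b} = (Fintype.card (Fin n → α) : ℝ)⁻¹ := fun b => by
    have : μ {b} = ∏ i, ν {b i} := Measure.pi_singleton _ _
    rw [Measure.real, this, ENNReal.toReal_prod]
    change ∏ i, ν.real {b i} = _
    simp [hν]
  have hind : iIndepFun (fun (i : Fin n) (b : Fin n → α) => f (b i) - ∫ a, f a ∂ν) μ :=
    iIndepFun_pi (X := fun _ a => f a - ∫ a, f a ∂ν) fun _ => (hmeas _).aemeasurable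
  have hsub : ∀ i ∈ (Finset.univ : Finset (Fin n)), HasSubgaussianMGF
      (fun b : Fin n → α => f (b i) - ∫ a, f a ∂ν) ((‖(1 : ℝ) - 0‖₊ / 2) ^ 2) μ := by
    intro i _
    have h1 : HasSubgaussianMGF (fun a => f a - ∫ a, f a ∂ν) ((‖(1 : ℝ) - 0‖₊ / 2) ^ 2) ν :=
      hasSubgaussianMGF_of_mem_Icc (hmeas f).aemeasurable (Filter.Eventually.of_forall hf)
    -- Each coordinate has law `ν`, so the sub-Gaussian bound transfers from `ν` to `μ`.
    have h2 : μ.map (fun b => b i) = ν := (measurePreserving_eval (fun _ => ν) i).map_eq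
    rw [← h2] at h1
    have := HasSubgaussianMGF.of_map (Y := fun b : Fin n → α => b i)
      (measurable_pi_apply i).aemeasurable h1
    rw [h2] at this
    exact this
  have hn' : (0 : ℝ) < n := by exact_mod_cast hn
  have key := HasSubgaussianMGF.measure_sum_ge_le_of_iIndepFun hind hsub
    (ε := n * ε) (by positivity)
  rw [unifProb_eq_measureReal μ hμ]
  convert key using 2
  · congr 1
    ext b
    simp only [Finset.sum_sub_distrib, Finset.sum_const, Finset.card_univ,
      Fintype.card_fin, nsmul_eq_mul, hint]
    rw [le_div_iff₀ hn']
    constructor <;> intro h <;> nlinarith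
  · simp
    field_simp

end Hoeffding

theorem sum_indicator_eq {α : Type} [Fintype α] (E : α → Prop) [DecidablePred E] :
    (∑ a, if E a then (1 : ℝ) else 0) / Fintype.card α = unifProb E := by
  classical
  rw [Finset.sum_boole, unifProb]
  congr!

theorem hoeffding_upper {α : Type} [Fintype α] [Nonempty α] (E : α → Prop) [DecidablePred E]
    (n : ℕ) (hn : 0 < n) (ε : ℝ) (hε : 0 ≤ ε) :
    unifProb (fun b : Fin n → α =>
      unifProb E + ε ≤ ((Finset.univ.filter fun i => E (b i)).card : ℝ) / n)
        ≤ Real.exp (-(2 * n * ε ^ 2)) := by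
  have h := hoeffding_unifProb (fun a => if E a then (1 : ℝ) else 0)
    (fun a => by split_ifs <;> simp) n hn ε hε
  rw [sum_indicator_eq] at h
  simpa only [Finset.sum_boole] using h

/-- This is the upper tail for the complementary event, since passing to the complement replaces
both frequency and probability by one minus themselves. -/
theorem hoeffding_lower {α : Type} [Fintype α] [Nonempty α] (E : α → Prop) [DecidablePred E]
    (n : ℕ) (hn : 0 < n) (ε : ℝ) (hε : 0 ≤ ε) :
    unifProb (fun b : Fin n → α =>
      ((Finset.univ.filter fun i => E (b i)).card : ℝ) / n ≤ unifProb E - ε)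
        ≤ Real.exp (-(2 * n * ε ^ 2)) := by
  refine le_trans (unifProb_mono fun b hb => ?_) (hoeffding_upper (fun a => ¬ E a) n hn ε hε)
  have hn' : (n : ℝ) ≠ 0 := by positivity
  have h := Finset.card_filter_add_card_filter_not (s := (Finset.univ : Finset (Fin n)))
    (fun i => E (b i))
  rw [Finset.card_univ, Fintype.card_fin] at h
  have h' : ((Finset.univ.filter fun i => E (b i)).card : ℝ) / n +
      ((Finset.univ.filter fun i => ¬ E (b i)).card : ℝ) / n = 1 := by
    rw [← add_div, div_eq_one_iff_eq hn']
    exact_mod_cast h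
  rw [unifProb_not]
  linarith

/-! ### The sampling test -/

/-- Vectors that agree with `x` on `S` correspond to the choices of the entries off `S`. -/
def completionEquiv {d : ℕ} (x : Fin d → Bool) (S : Finset (Fin d)) :
    ({i // i ∉ S} → Bool) ≃ {y : Fin d → Bool // ∀ i ∈ S, y i = x i} where
  toFun b := ⟨completion x S b, fun i hi => by simp [completion, hi]⟩
  invFun y := fun i => y.1 i.1
  left_inv b := by
    funext i
    simp [completion, i.2]
  right_inv y := by
    ext i
    by_cases hi : i ∈ S
    · simp [completion, hi, y.2 i hi]
    · simp [completion, hi]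

/-- Numerators and denominators agree separately, so an empty condition needs no exception. -/
theorem unifCondProb_eq_unifProb_subtype {α : Type} [Fintype α] (E F : α → Prop)
    [Fintype {a // F a}] : unifCondProb E F = unifProb fun a : {a // F a} => E a := by
  classical
  unfold unifCondProb unifProb
  rw [Fintype.card_subtype]
  congr 2
  · refine Finset.card_bij' (fun a h => ⟨a, by simp at h; exact h.2⟩) (fun a _ => a.1) ?_ ?_ ?_ ?_
    · intro a h
      simp at h ⊢
      exact h.1
    · intro a h
      simp at h ⊢
      exact ⟨h, a.2⟩
    · simp
    · simp

/-- Brings the conditional probability into the form that Hoeffding's inequality uses: a probability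
over free bits off `S`. -/
theorem isRelevant_iff {d : ℕ} (δ : ℝ) (Φ : (Fin d → Bool) → Bool) (x : Fin d → Bool)
    (S : Finset (Fin d)) :
    IsRelevant δ Φ x S ↔
      δ ≤ unifProb fun b : {i // i ∉ S} → Bool => Φ (completion x S b) = Φ x := by
  classical
  rw [IsRelevant, unifCondProb_eq_unifProb_subtype, ← unifProb_comp_equiv (completionEquiv x S)]
  rfl

/-- The sample size is chosen so that `2 n (γ / 2)² = n γ² / 2 ≥ log 3`. -/
theorem exp_neg_sample_size_le {γ : ℝ} (hγ : 0 < γ) :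
    0 < ⌈2 * Real.log 3 / γ ^ 2⌉₊ ∧
      Real.exp (-(2 * (⌈2 * Real.log 3 / γ ^ 2⌉₊ : ℝ) * (γ / 2) ^ 2)) ≤ 1 / 3 := by
  have h3 : 0 < Real.log 3 := Real.log_pos (by norm_num)
  refine ⟨Nat.ceil_pos.2 (by positivity), ?_⟩
  have h : 2 * Real.log 3 / γ ^ 2 ≤ (⌈2 * Real.log 3 / γ ^ 2⌉₊ : ℝ) := Nat.le_ceil _
  rw [div_le_iff₀ (by positivity)] at h
  calc _ ≤ Real.exp (-Real.log 3) := Real.exp_le_exp.2 (by nlinarith)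
    _ = 1 / 3 := by rw [Real.exp_neg, Real.exp_log (by norm_num)]; norm_num

theorem sampleMean_ge_of_isRelevant {δ γ : ℝ} (hγ : 0 < γ) {d : ℕ} {Φ : (Fin d → Bool) → Bool}
    {x : Fin d → Bool} {S : Finset (Fin d)} (h : IsRelevant δ Φ x S) :
    2 / 3 ≤ unifProb fun b : Fin ⌈2 * Real.log 3 / γ ^ 2⌉₊ → {i // i ∉ S} → Bool =>
      δ - γ / 2 ≤ sampleMean Φ x S b := by
  rw [isRelevant_iff] at h
  obtain ⟨hn, hexp⟩ := exp_neg_sample_size_le hγ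
  have h1 := (hoeffding_lower (fun b : {i // i ∉ S} → Bool => Φ (completion x S b) = Φ x) _ hn
    (γ / 2) (by positivity)).trans hexp
  have h2 := unifProb_not fun b : Fin ⌈2 * Real.log 3 / γ ^ 2⌉₊ → {i // i ∉ S} → Bool =>
    δ - γ / 2 ≤ sampleMean Φ x S b
  have h3 : unifProb (fun b : Fin ⌈2 * Real.log 3 / γ ^ 2⌉₊ → {i // i ∉ S} → Bool =>
      ¬ δ - γ / 2 ≤ sampleMean Φ x S b) ≤ 1 / 3 := by
    refine le_trans (unifProb_mono fun b hb => ?_) h1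
    rw [not_le, sampleMean] at hb
    linarith
  linarith

theorem sampleMean_lt_of_not_isRelevant {δ γ : ℝ} (hγ : 0 < γ) {d : ℕ}
    {Φ : (Fin d → Bool) → Bool} {x : Fin d → Bool} {S : Finset (Fin d)}
    (h : ¬ IsRelevant (δ - γ) Φ x S) :
    2 / 3 ≤ unifProb fun b : Fin ⌈2 * Real.log 3 / γ ^ 2⌉₊ → {i // i ∉ S} → Bool =>
      sampleMean Φ x S b < δ - γ / 2 := by
  rw [isRelevant_iff, not_le] at h
  obtain ⟨hn, hexp⟩ := exp_neg_sample_size_le hγ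
  have h1 := (hoeffding_upper (fun b : {i // i ∉ S} → Bool => Φ (completion x S b) = Φ x) _ hn
    (γ / 2) (by positivity)).trans hexp
  have h2 := unifProb_not fun b : Fin ⌈2 * Real.log 3 / γ ^ 2⌉₊ → {i // i ∉ S} → Bool =>
    sampleMean Φ x S b < δ - γ / 2
  have h3 : unifProb (fun b : Fin ⌈2 * Real.log 3 / γ ^ 2⌉₊ → {i // i ∉ S} → Bool =>
      ¬ sampleMean Φ x S b < δ - γ / 2) ≤ 1 / 3 := by
    refine le_trans (unifProb_mono fun b hb => ?_) h1
    rw [not_lt, sampleMean] at hb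
    linarith
  linarith

/-! ### Runs of machines -/

namespace ChoiceMachine

variable {M : ChoiceMachine} {A : Language Bool}

theorem step_of_halted {c : M.Cfg} (h : c.l = none) (b : Bool) : M.step A c b = c := by
  obtain ⟨l, v, S⟩ := c
  obtain rfl : l = none := h
  rfl

theorem foldl_step_of_halted {c : M.Cfg} (h : c.l = none) (r : List Bool) :
    r.foldl (M.step A) c = c := by
  induction r with
  | nil => rfl
  | cons b r ih => rw [List.foldl_cons, step_of_halted h, ih]

/-- A machine all of whose steps decrease the potential `Φ` halts within `Φ c` steps. -/
theorem halts_of_potential (Φ : M.Cfg → ℕ)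
    (hΦ : ∀ c b, c.l ≠ none → Φ (M.step A c b) < Φ c) :
    ∀ (r : List Bool) (c : M.Cfg), Φ c ≤ r.length → (r.foldl (M.step A) c).l = none
  | [], c, h => by
      by_contra hc
      have := hΦ c false hc
      simp at h
      omega
  | b :: r, c, h => by
      by_cases hc : c.l = none
      · rw [foldl_step_of_halted hc, hc]
      · have := hΦ c b hc
        rw [List.length_cons] at h
        exact halts_of_potential Φ hΦ r _ (by omega)

/-- From `c` the machine gets to `c'` after some number of steps, whatever the choices are. -/
def Reaches (M : ChoiceMachine) (A : Language Bool) (c c' : M.Cfg) : Prop :=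
  ∃ s : ℕ, ∀ r : List Bool, r.length = s → r.foldl (M.step A) c = c'

theorem Reaches.refl (c : M.Cfg) : M.Reaches A c c :=
  ⟨0, fun r hr => by rw [List.length_eq_zero_iff.1 hr]; rfl⟩

theorem Reaches.trans {c₁ c₂ c₃ : M.Cfg} (h₁ : M.Reaches A c₁ c₂) (h₂ : M.Reaches A c₂ c₃) :
    M.Reaches A c₁ c₃ := by
  obtain ⟨s₁, h₁⟩ := h₁
  obtain ⟨s₂, h₂⟩ := h₂
  refine ⟨s₁ + s₂, fun r hr => ?_⟩
  rw [← List.take_append_drop s₁ r, List.foldl_append, h₁ _ (by simp [hr]), h₂ _ (by simp [hr])]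

theorem Reaches.head {c₁ c₂ c₃ : M.Cfg} (h₁ : ∀ b, M.step A c₁ b = c₂)
    (h₂ : M.Reaches A c₂ c₃) : M.Reaches A c₁ c₃ := by
  refine Reaches.trans ⟨1, fun r hr => ?_⟩ h₂
  obtain ⟨b, rfl⟩ := List.length_eq_one_iff.1 hr
  exact h₁ b

/-- Halted configurations are fixed, so the unknown step count in `Reaches` does not matter: a
longer run stays at `c'`, and a shorter run that has already halted may be padded with arbitrary
choices. Exact step counts are therefore never needed. -/
theorem Reaches.foldl_eq {c c' : M.Cfg} (h : M.Reaches A c c') (hc' : c'.l = none)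
    {r : List Bool} (hr : (r.foldl (M.step A) c).l = none) : r.foldl (M.step A) c = c' := by
  obtain ⟨s, h⟩ := h
  by_cases hs : s ≤ r.length
  · rw [← List.take_append_drop s r, List.foldl_append, h _ (by simp [hs]),
      foldl_step_of_halted hc']
  · rw [← h (r ++ List.replicate (s - r.length) false) (by simp; omega), List.foldl_append,
      foldl_step_of_halted hr]

end ChoiceMachine

/-! ### The guessing machine -/

/-- The labels of the guessing machine. -/
inductive GuessLabel
  | read
  | query
  | yes
  | no
  deriving DecidableEq

instance : Fintype GuessLabel :=
  ⟨{.read, .query, .yes, .no}, by rintro (_ | _ | _ | _) <;> simp⟩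

/-- A nondeterministic oracle machine that attaches a guessed bit to every letter of the input
and accepts if the oracle contains the annotated word. The input is on the stack `false`, the
query on the stack `true`. -/
def guesser : ChoiceMachine where
  K := Bool
  Γ _ := Bool
  finΓ _ := inferInstance
  Λ := GuessLabel
  σ := Option Bool
  inStack := false
  queryStack := true
  inBit := Equiv.refl _
  queryBit := Equiv.refl _
  main := .read
  start := none
  prog b
    | .read => .pop false (fun _ a => a) (.branch Option.isSome
        (.push true (fun a => a.getD false) (.push true (fun _ => b)
          (.load (fun _ => none) (.goto fun _ => .read))))
        (.goto fun _ => .query))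
    | .query => .halt
    | .yes => .load (fun _ => some true) .halt
    | .no => .halt
  ask
    | .query => some (.yes, .no)
    | _ => none
  accepting a := a.getD false

namespace guesser

/-- The word to which the annotated input `L` is turned: its reversal, with every letter preceded
by its annotation. -/
def queryWord (L : List (Bool × Bool)) : List Bool :=
  L.reverse.flatMap fun p => [p.2, p.1]

theorem length_queryWord (L : List (Bool × Bool)) : (queryWord L).length = 2 * L.length := by
  simp [queryWord, List.length_flatMap, mul_comm]

/-- The stacks of the guessing machine. -/
def twoStacks (w q : List Bool) : Bool → List Bool
  | false => w
  | true => q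

/-- A configuration of the guessing machine. -/
abbrev cfg (l : Option GuessLabel) (v : Option Bool) (w q : List Bool) : guesser.Cfg :=
  { l := l, var := v, stk := twoStacks w q }

variable {A : Language Bool}

theorem initCfg_eq (w : List Bool) : guesser.initCfg w = cfg (some .read) none w [] := by
  change (⟨_, _, _⟩ : guesser.Cfg) = ⟨_, _, _⟩
  congr 1
  funext k
  cases k
  · exact List.map_id w
  · rfl

theorem step_read_cons (a b : Bool) (v : Option Bool) (w q : List Bool) :
    guesser.step A (cfg (some .read) v (a :: w) q) b = cfg (some .read) none w (b :: a :: q) := by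
  -- Label and state agree by computation; only the stacks, as functions, have to be compared one by
  -- one.
  change (⟨_, _, _⟩ : guesser.Cfg) = ⟨_, _, _⟩
  congr 1
  funext k; cases k <;> rfl

theorem step_read_nil (b : Bool) (v : Option Bool) (q : List Bool) :
    guesser.step A (cfg (some .read) v [] q) b = cfg (some .query) none [] q := by
  change (⟨_, _, _⟩ : guesser.Cfg) = ⟨_, _, _⟩
  congr 1
  funext k; cases k <;> rfl

open Classical in
theorem step_query (b : Bool) (v : Option Bool) (w q : List Bool) :
    guesser.step A (cfg (some .query) v w q) b =
      cfg (some (if q ∈ A then .yes else .no)) v w [] := by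
  change (⟨some (if q.map id ∈ A then _ else _), _, _⟩ : guesser.Cfg) = ⟨_, _, _⟩
  rw [List.map_id]
  congr 1
  funext k; cases k <;> rfl

theorem step_yes (b : Bool) (v : Option Bool) (w q : List Bool) :
    guesser.step A (cfg (some .yes) v w q) b = cfg none (some true) w q := rfl

theorem step_no (b : Bool) (v : Option Bool) (w q : List Bool) :
    guesser.step A (cfg (some .no) v w q) b = cfg none v w q := rfl

theorem foldl_read (L : List (Bool × Bool)) (q : List Bool) :
    (L.map Prod.snd).foldl (guesser.step A) (cfg (some .read) none (L.map Prod.fst) q) =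
      cfg (some .read) none [] (queryWord L ++ q) := by
  induction L generalizing q with
  | nil => rfl
  | cons p L ih =>
    rw [List.map_cons, List.map_cons, List.foldl_cons, step_read_cons, ih]
    simp [queryWord]

/-- The last three steps notice the empty input, ask the oracle and halt; their choice bits have no
effect. -/
theorem run_eq (L : List (Bool × Bool)) (b₁ b₂ b₃ : Bool) :
    (guesser.run A (L.map Prod.fst) (L.map Prod.snd ++ [b₁, b₂, b₃])).l = none ∧
      (guesser.accepting (guesser.run A (L.map Prod.fst)
        (L.map Prod.snd ++ [b₁, b₂, b₃])).var = true ↔ queryWord L ∈ A) := by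
  classical
  rw [ChoiceMachine.run, initCfg_eq, List.foldl_append, foldl_read, List.append_nil,
    List.foldl_cons, step_read_nil, List.foldl_cons, step_query, List.foldl_cons]
  by_cases h : queryWord L ∈ A
  · rw [if_pos h, step_yes, List.foldl_nil]
    simp [h, guesser]
  · rw [if_neg h, step_no, List.foldl_nil]
    simp [h, guesser]

/-- The guessing machine runs in time `m + 3`. -/
noncomputable def time : Polynomial ℕ := Polynomial.X + Polynomial.C 3

theorem eval_time (m : ℕ) : time.eval m = m + 3 := by simp [time]

/-- Makes quantification over computations the same as quantification over annotations. -/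
theorem exists_split (w r : List Bool) (hr : r.length = w.length + 3) :
    ∃ (L : List (Bool × Bool)) (b₁ b₂ b₃ : Bool), w = L.map Prod.fst ∧
      r = L.map Prod.snd ++ [b₁, b₂, b₃] := by
  obtain ⟨b₁, b₂, b₃, h⟩ := List.length_eq_three.1
    (show (r.drop w.length).length = 3 by simp [hr])
  refine ⟨w.zip (r.take w.length), b₁, b₂, b₃, ?_, ?_⟩
  · rw [List.map_fst_zip]; simp [hr]
  · rw [List.map_snd_zip (by simp), ← h, List.take_append_drop]

theorem runsInTime : guesser.RunsInTime time := by
  intro A w r hr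
  rw [eval_time] at hr
  obtain ⟨L, b₁, b₂, b₃, rfl, rfl⟩ := exists_split w r hr
  exact (run_eq L b₁ b₂ b₃).1

theorem exists_accepts_iff (w : List Bool) :
    (∃ r : List Bool, r.length = time.eval w.length ∧ guesser.Accepts A w r) ↔
      ∃ L : List (Bool × Bool), L.map Prod.fst = w ∧ queryWord L ∈ A := by
  constructor
  · rintro ⟨r, hr, hacc⟩
    rw [eval_time] at hr
    obtain ⟨L, b₁, b₂, b₃, rfl, rfl⟩ := exists_split w r hr
    exact ⟨L, rfl, (run_eq L b₁ b₂ b₃).2.1 hacc.2⟩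
  · rintro ⟨L, rfl, hL⟩
    refine ⟨L.map Prod.snd ++ [false, false, false], by simp [eval_time], ?_⟩
    exact ⟨(run_eq L _ _ _).1, (run_eq L _ _ _).2.2 hL⟩

end guesser

/-- A promise problem belongs to `NP^C` if its instances, annotated with arbitrary bits, are
decided by some `Q ∈ C`. -/
theorem mem_NPRel_of_annotation {C : Set PromiseProblem} {P Q : PromiseProblem} (hQ : Q ∈ C)
    (hyes : ∀ w ∈ P.yes, ∃ L : List (Bool × Bool), L.map Prod.fst = w ∧
      guesser.queryWord L ∈ Q.yes)
    (hno : ∀ w ∈ P.no, ∀ L : List (Bool × Bool), L.map Prod.fst = w →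
      guesser.queryWord L ∈ Q.no) : P ∈ NPRel C := by
  refine ⟨Q, hQ, guesser, guesser.time, guesser.runsInTime, fun A hA => ⟨fun w hw => ?_,
    fun w hw => ?_⟩⟩
  · obtain ⟨L, hL, hLQ⟩ := hyes w hw
    exact (guesser.exists_accepts_iff w).2 ⟨L, hL, hA.1 _ hLQ⟩
  · rw [guesser.exists_accepts_iff]
    rintro ⟨L, hL, hLA⟩
    exact hA.2 _ (hno w hw L hL) hLA

/-! ### The sampling machine -/

/-- One random bit for each of the `N + 1` samples. -/
abbrev SampleBits (N : ℕ) : Type := Fin (N + 1) → Bool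

/-- One value for the given vector (`none`) and one for each of the `N + 1` samples. -/
abbrev SampleValues (N : ℕ) : Type := Option (Fin (N + 1)) → Bool

/-- A letter of the input with its annotation and its random bits. -/
abbrev SampleLetter (N : ℕ) : Type := Bool × Bool × SampleBits N

/-- If `p.1` is an entry of the vector `x` and `p.2.1` tells whether its index belongs to `S`,
these are the entries at this index of `x` and of the random completions. -/
def SampleLetter.values {N : ℕ} (p : SampleLetter N) : SampleValues N :=
  fun o => o.elim p.1 fun j => bif p.2.1 then p.1 else p.2.2 j

/-- The stacks of the sampling machine: the input, the text (the input in the original order with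
random bits), a counter, the variables that are unread and read, and the values of
subexpressions. -/
inductive SamplerStack
  | input
  | text
  | counter
  | unread
  | read
  | values
  deriving DecidableEq

instance : Fintype SamplerStack :=
  ⟨{.input, .text, .counter, .unread, .read, .values}, by
    rintro (_ | _ | _ | _ | _ | _) <;> simp⟩

/-- The stack symbols of the sampling machine. -/
def SamplerSymbol (N : ℕ) : SamplerStack → Type
  | .input => Bool
  | .text => SampleLetter N
  | .counter => Unit
  | .unread => SampleValues N
  | .read => SampleValues N
  | .values => SampleValues N

instance (N : ℕ) : ∀ k, Fintype (SamplerSymbol N k)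
  | .input => inferInstanceAs (Fintype Bool)
  | .text => inferInstanceAs (Fintype (SampleLetter N))
  | .counter => inferInstanceAs (Fintype Unit)
  | .unread => inferInstanceAs (Fintype (SampleValues N))
  | .read => inferInstanceAs (Fintype (SampleValues N))
  | .values => inferInstanceAs (Fintype (SampleValues N))

/-- The labels of the sampling machine. -/
inductive SamplerLabel
  | draw
  | count
  | vector
  | restore
  | token
  | index
  | operator
  | binary
  deriving DecidableEq

instance : Fintype SamplerLabel :=
  ⟨{.draw, .count, .vector, .restore, .token, .index, .operator, .binary}, by
    rintro (_ | _ | _ | _ | _ | _ | _ | _) <;> simp⟩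

/-- The internal states of the sampling machine: a flag for acceptance, the random bits that have
been drawn, and registers for symbols taken from the stacks. -/
structure SamplerState (N : ℕ) where
  ok : Bool
  pos : Fin (N + 1) := 0
  bits : SampleBits N := fun _ => false
  a : Option Bool := none
  b : Option Bool := none
  p : Option (SampleLetter N) := none
  c : Option Unit := none
  u : Option (SampleValues N) := none
  v : Option (SampleValues N) := none

noncomputable instance (N : ℕ) : Fintype (SamplerState N) :=
  Fintype.ofInjective (fun s => (s.ok, s.pos, s.bits, s.a, s.b, s.p, s.c, s.u, s.v)) (by
    rintro ⟨⟩ ⟨⟩ h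
    simpa using h)

namespace SamplerState

variable {N : ℕ}

/-- The state in which only the flag is kept. -/
def clear (s : SamplerState N) : SamplerState N := { ok := s.ok }

/-- The letter in the register `p`. -/
def letter (s : SamplerState N) : Bool := (s.p.getD default).1

end SamplerState

open Turing.TM2.Stmt in
/-- The program of the sampling machine. -/
def samplerProg (N : ℕ) (P : SampleValues N → Bool) (r : Bool) :
    SamplerLabel → Turing.TM2.Stmt (SamplerSymbol N) SamplerLabel (SamplerState N)
  | .draw =>
      load (fun s => { s with bits := Function.update s.bits s.pos r, pos := s.pos + 1 }) <|
      -- The position counts modulo `N + 1`, so 0 after the increment means that all `N + 1` bits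
      -- have been drawn.
      branch (fun s => decide (s.pos = 0))
        (pop .input (fun s o => { s with b := o }) <|
          pop .input (fun s o => { s with a := o }) <|
          branch (fun s => s.a.isSome)
            (push .text (fun s => (s.a.getD false, s.b.getD false, s.bits)) <|
              load .clear <| goto fun _ => .draw)
            (load .clear <| goto fun _ => .count))
        (goto fun _ => .draw)
  | .count =>
      pop .text (fun s o => { s with p := o }) <|
      branch (fun s => s.letter)
        (push .counter (fun _ => ()) <| load .clear <| goto fun _ => .count)
        (load .clear <| goto fun _ => .vector)
  | .vector =>
      pop .text (fun s o => { s with p := o }) <|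
      branch (fun s => s.letter)
        (pop .text (fun s o => { s with p := o }) <|
          push .read (fun s => (s.p.getD default).values) <|
          branch (fun s => (s.p.getD default).2.1)
            -- Each element of `S` uses up one counter symbol; a failed pop clears the flag for
            -- good.
            (pop .counter (fun s o => { s with c := o }) <|
              load (fun s => { ok := s.ok && s.c.isSome }) <| goto fun _ => .vector)
            (load .clear <| goto fun _ => .vector))
        (load .clear <| goto fun _ => .restore)
  | .restore =>
      pop .read (fun s o => { s with u := o }) <|
      branch (fun s => s.u.isSome)
        (push .unread (fun s => s.u.getD default) <| load .clear <| goto fun _ => .restore)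
        (load .clear <| goto fun _ => .token)
  | .token =>
      pop .text (fun s o => { s with p := o }) <|
      branch (fun s => s.p.isSome)
        (branch (fun s => s.letter)
          (load .clear <| goto fun _ => .operator)
          (load .clear <| goto fun _ => .index))
        (pop .values (fun s o => { s with u := o }) <|
          load (fun s => { ok := s.ok && P (s.u.getD default) }) halt)
  | .index =>
      pop .text (fun s o => { s with p := o }) <|
      branch (fun s => s.letter)
        (pop .unread (fun s o => { s with u := o }) <|
          push .read (fun s => s.u.getD default) <| load .clear <| goto fun _ => .index)
        (peek .unread (fun s o => { s with u := o }) <|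
          -- Going back through `restore` rewinds the list of variables for the next lookup.
          push .values (fun s => s.u.getD default) <| load .clear <| goto fun _ => .restore)
  | .operator =>
      pop .text (fun s o => { s with p := o }) <|
      branch (fun s => s.letter)
        (load .clear <| goto fun _ => .binary)
        (pop .values (fun s o => { s with u := o }) <|
          push .values (fun s o => !(s.u.getD default o)) <| load .clear <| goto fun _ => .token)
  | .binary =>
      pop .text (fun s o => { s with p := o }) <|
      pop .values (fun s o => { s with u := o }) <|
      pop .values (fun s o => { s with v := o }) <|
      push .values (fun s o => bif s.letter then s.v.getD default o || s.u.getD default o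
        else s.v.getD default o && s.u.getD default o) <|
      load .clear <| goto fun _ => .token

/-- The sampling machine. It reads the reversal of a word whose letters are annotated with bits,
and attaches `N + 1` random bits to every letter. If the word describes an instance `(Φ, x, k)`
and the annotations of the entries of `x` describe a set `S`, it then checks that `S` has at most
`k` elements, evaluates `Φ` simultaneously at `x` and at `N + 1` random completions, and applies
the test `P` to the values. -/
noncomputable def sampler (N : ℕ) (P : SampleValues N → Bool) : ChoiceMachine where
  K := SamplerStack
  Γ := SamplerSymbol N
  Λ := SamplerLabel
  σ := SamplerState N
  inStack := .input
  queryStack := .input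
  inBit := Equiv.refl Bool
  queryBit := Equiv.refl Bool
  main := .draw
  start := { ok := true }
  prog := samplerProg N P
  ask _ := none
  accepting s := s.ok

namespace sampler

variable {N : ℕ} {P : SampleValues N → Bool} {A : Language Bool}

/-- The stacks of the sampling machine. -/
def contents (i : List Bool) (t : List (SampleLetter N)) (c : List Unit)
    (x y v : List (SampleValues N)) : ∀ k, List (SamplerSymbol N k)
  | .input => i
  | .text => t
  | .counter => c
  | .unread => x
  | .read => y
  | .values => v

/-- A configuration of the sampling machine. -/
abbrev cfg (P : SampleValues N → Bool) (l : Option SamplerLabel) (s : SamplerState N)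
    (i : List Bool) (t : List (SampleLetter N)) (c : List Unit)
    (x y v : List (SampleValues N)) : (sampler N P).Cfg :=
  { l := l, var := s, stk := contents i t c x y v }

theorem exists_eq_cfg (c : (sampler N P).Cfg) :
    ∃ l s i t k x y v, c = cfg P l s i t k x y v := by
  refine ⟨c.l, c.var, c.stk .input, c.stk .text, c.stk .counter, c.stk .unread, c.stk .read,
    c.stk .values, ?_⟩
  obtain ⟨l, s, S⟩ := c
  change (⟨_, _, _⟩ : (sampler N P).Cfg) = ⟨_, _, _⟩
  congr 1
  funext k; cases k <;> rfl

theorem initCfg_eq (w : List Bool) :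
    (sampler N P).initCfg w = cfg P (some .draw) { ok := true } w [] [] [] [] [] := by
  change (⟨_, _, _⟩ : (sampler N P).Cfg) = ⟨_, _, _⟩
  congr 1
  funext k
  cases k
  · exact List.map_id w
  all_goals rfl

/-! ### Single steps of the sampling machine, by label and stack contents -/

section Steps

variable (r : Bool) (s : SamplerState N) (i : List Bool) (t : List (SampleLetter N))
  (c : List Unit) (x y v : List (SampleValues N))

theorem step_draw (h : s.pos + 1 ≠ 0) :
    (sampler N P).step A (cfg P (some .draw) s i t c x y v) r =
      cfg P (some .draw) { s with bits := Function.update s.bits s.pos r, pos := s.pos + 1 }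
        i t c x y v := by
  -- This branch depends on a variable position and does not reduce by itself, so the condition is
  -- rewritten by hand.
  change cond (decide (s.pos + 1 = 0)) _ _ = _
  rw [decide_eq_false h]
  rfl

theorem step_draw_last_cons (h : s.pos + 1 = 0) (a b : Bool) :
    (sampler N P).step A (cfg P (some .draw) s (b :: a :: i) t c x y v) r =
      cfg P (some .draw) s.clear i ((a, b, Function.update s.bits s.pos r) :: t) c x y v := by
  change cond (decide (s.pos + 1 = 0)) _ _ = _
  rw [decide_eq_true h]
  change (⟨_, _, _⟩ : (sampler N P).Cfg) = ⟨_, _, _⟩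
  congr 1
  funext k; cases k <;> rfl

theorem step_draw_last_nil (h : s.pos + 1 = 0) :
    (sampler N P).step A (cfg P (some .draw) s [] t c x y v) r =
      cfg P (some .count) s.clear [] t c x y v := by
  change cond (decide (s.pos + 1 = 0)) _ _ = _
  rw [decide_eq_true h]
  change (⟨_, _, _⟩ : (sampler N P).Cfg) = ⟨_, _, _⟩
  congr 1
  funext k; cases k <;> rfl

theorem step_draw_last_singleton (h : s.pos + 1 = 0) (b : Bool) :
    (sampler N P).step A (cfg P (some .draw) s [b] t c x y v) r =
      cfg P (some .count) s.clear [] t c x y v := by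
  change cond (decide (s.pos + 1 = 0)) _ _ = _
  rw [decide_eq_true h]
  change (⟨_, _, _⟩ : (sampler N P).Cfg) = ⟨_, _, _⟩
  congr 1
  funext k; cases k <;> rfl

theorem step_count_nil :
    (sampler N P).step A (cfg P (some .count) s i [] c x y v) r =
      cfg P (some .vector) s.clear i [] c x y v := by
  change (⟨_, _, _⟩ : (sampler N P).Cfg) = ⟨_, _, _⟩
  congr 1
  funext k; cases k <;> rfl

theorem step_count_true (p : Bool × SampleBits N) :
    (sampler N P).step A (cfg P (some .count) s i ((true, p) :: t) c x y v) r =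
      cfg P (some .count) s.clear i t (() :: c) x y v := by
  change (⟨_, _, _⟩ : (sampler N P).Cfg) = ⟨_, _, _⟩
  congr 1
  funext k; cases k <;> rfl

theorem step_count_false (p : Bool × SampleBits N) :
    (sampler N P).step A (cfg P (some .count) s i ((false, p) :: t) c x y v) r =
      cfg P (some .vector) s.clear i t c x y v := by
  change (⟨_, _, _⟩ : (sampler N P).Cfg) = ⟨_, _, _⟩
  congr 1
  funext k; cases k <;> rfl

theorem step_vector_nil :
    (sampler N P).step A (cfg P (some .vector) s i [] c x y v) r =
      cfg P (some .restore) s.clear i [] c x y v := by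
  change (⟨_, _, _⟩ : (sampler N P).Cfg) = ⟨_, _, _⟩
  congr 1
  funext k; cases k <;> rfl

theorem step_vector_false (p : Bool × SampleBits N) :
    (sampler N P).step A (cfg P (some .vector) s i ((false, p) :: t) c x y v) r =
      cfg P (some .restore) s.clear i t c x y v := by
  change (⟨_, _, _⟩ : (sampler N P).Cfg) = ⟨_, _, _⟩
  congr 1
  funext k; cases k <;> rfl

theorem step_vector_true_nil (p : Bool × SampleBits N) :
    (sampler N P).step A (cfg P (some .vector) s i [(true, p)] c x y v) r =
      cfg P (some .vector) s.clear i [] c x (SampleLetter.values default :: y) v := by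
  change (⟨_, _, _⟩ : (sampler N P).Cfg) = ⟨_, _, _⟩
  congr 1
  funext k; cases k <;> rfl

theorem step_vector_true_off (p : Bool × SampleBits N) (a : Bool) (q : SampleBits N) :
    (sampler N P).step A (cfg P (some .vector) s i ((true, p) :: (a, false, q) :: t) c x y v) r =
      cfg P (some .vector) s.clear i t c x (SampleLetter.values (a, false, q) :: y) v := by
  change (⟨_, _, _⟩ : (sampler N P).Cfg) = ⟨_, _, _⟩
  congr 1
  funext k; cases k <;> rfl

theorem step_vector_true_on (p : Bool × SampleBits N) (a : Bool) (q : SampleBits N) :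
    (sampler N P).step A (cfg P (some .vector) s i ((true, p) :: (a, true, q) :: t) c x y v) r =
      cfg P (some .vector) { ok := s.ok && c.head?.isSome } i t c.tail x
        (SampleLetter.values (a, true, q) :: y) v := by
  change (⟨_, _, _⟩ : (sampler N P).Cfg) = ⟨_, _, _⟩
  congr 1
  funext k; cases k <;> rfl

theorem step_restore_nil :
    (sampler N P).step A (cfg P (some .restore) s i t c x [] v) r =
      cfg P (some .token) s.clear i t c x [] v := by
  change (⟨_, _, _⟩ : (sampler N P).Cfg) = ⟨_, _, _⟩
  congr 1
  funext k; cases k <;> rfl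

theorem step_restore_cons (z : SampleValues N) :
    (sampler N P).step A (cfg P (some .restore) s i t c x (z :: y) v) r =
      cfg P (some .restore) s.clear i t c (z :: x) y v := by
  change (⟨_, _, _⟩ : (sampler N P).Cfg) = ⟨_, _, _⟩
  congr 1
  funext k; cases k <;> rfl

theorem step_token_nil :
    (sampler N P).step A (cfg P (some .token) s i [] c x y v) r =
      cfg P none { ok := s.ok && P (v.head?.getD default) } i [] c x y v.tail := by
  change (⟨_, _, _⟩ : (sampler N P).Cfg) = ⟨_, _, _⟩
  congr 1
  funext k; cases k <;> rfl

theorem step_token_true (p : Bool × SampleBits N) :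
    (sampler N P).step A (cfg P (some .token) s i ((true, p) :: t) c x y v) r =
      cfg P (some .operator) s.clear i t c x y v := by
  change (⟨_, _, _⟩ : (sampler N P).Cfg) = ⟨_, _, _⟩
  congr 1
  funext k; cases k <;> rfl

theorem step_token_false (p : Bool × SampleBits N) :
    (sampler N P).step A (cfg P (some .token) s i ((false, p) :: t) c x y v) r =
      cfg P (some .index) s.clear i t c x y v := by
  change (⟨_, _, _⟩ : (sampler N P).Cfg) = ⟨_, _, _⟩
  congr 1
  funext k; cases k <;> rfl

theorem step_index_nil :
    (sampler N P).step A (cfg P (some .index) s i [] c x y v) r =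
      cfg P (some .restore) s.clear i [] c x y (x.head?.getD default :: v) := by
  change (⟨_, _, _⟩ : (sampler N P).Cfg) = ⟨_, _, _⟩
  congr 1
  funext k; cases k <;> rfl

theorem step_index_true (p : Bool × SampleBits N) :
    (sampler N P).step A (cfg P (some .index) s i ((true, p) :: t) c x y v) r =
      cfg P (some .index) s.clear i t c x.tail (x.head?.getD default :: y) v := by
  change (⟨_, _, _⟩ : (sampler N P).Cfg) = ⟨_, _, _⟩
  congr 1
  funext k; cases k <;> rfl

theorem step_index_false (p : Bool × SampleBits N) :
    (sampler N P).step A (cfg P (some .index) s i ((false, p) :: t) c x y v) r =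
      cfg P (some .restore) s.clear i t c x y (x.head?.getD default :: v) := by
  change (⟨_, _, _⟩ : (sampler N P).Cfg) = ⟨_, _, _⟩
  congr 1
  funext k; cases k <;> rfl

theorem step_operator_nil :
    (sampler N P).step A (cfg P (some .operator) s i [] c x y v) r =
      cfg P (some .token) s.clear i [] c x y ((fun o => !(v.head?.getD default o)) :: v.tail) := by
  change (⟨_, _, _⟩ : (sampler N P).Cfg) = ⟨_, _, _⟩
  congr 1
  funext k; cases k <;> rfl

theorem step_operator_true (p : Bool × SampleBits N) :
    (sampler N P).step A (cfg P (some .operator) s i ((true, p) :: t) c x y v) r =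
      cfg P (some .binary) s.clear i t c x y v := by
  change (⟨_, _, _⟩ : (sampler N P).Cfg) = ⟨_, _, _⟩
  congr 1
  funext k; cases k <;> rfl

theorem step_operator_false (p : Bool × SampleBits N) :
    (sampler N P).step A (cfg P (some .operator) s i ((false, p) :: t) c x y v) r =
      cfg P (some .token) s.clear i t c x y ((fun o => !(v.head?.getD default o)) :: v.tail) := by
  change (⟨_, _, _⟩ : (sampler N P).Cfg) = ⟨_, _, _⟩
  congr 1
  funext k; cases k <;> rfl

theorem step_binary :
    (sampler N P).step A (cfg P (some .binary) s i t c x y v) r =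
      cfg P (some .token) s.clear i t.tail c x y
        ((fun o => bif (t.head?.getD default).1
          then v.tail.head?.getD default o || v.head?.getD default o
          else v.tail.head?.getD default o && v.head?.getD default o) :: v.tail.tail) := by
  change (⟨_, _, _⟩ : (sampler N P).Cfg) = ⟨_, _, _⟩
  congr 1
  funext k; cases k <;> rfl

end Steps

/-! ### Running time of the sampling machine -/

/-- A bound for the number of remaining steps at a label, given the number of random bits drawn
and the numbers of symbols on the stacks `input`, `text` and `read`. -/
def remaining (N : ℕ) (l : Option SamplerLabel) (pos i t y : ℕ) : ℕ :=
  match l with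
  | none => 0
  -- A pair of input letters pays for resetting `N - pos` to `N` and for a text symbol of weight 6.
  -- A text symbol pays for label changes and for at most one new symbol on `read`, whose weight 1
  -- pays for moving it back.
  | some .draw => (N + 8) * i + (6 * t + y) + (N - pos) + 6
  | some .count => 6 * t + y + 5
  | some .vector => 6 * t + y + 4
  | some .restore => 6 * t + y + 2
  | some .token => 6 * t + y + 1
  | some .index => 6 * t + y + 3
  | some .operator => 6 * t + y + 3
  | some .binary => 6 * t + y + 3

/-- A quantity that every step decreases. -/
def potential (c : (sampler N P).Cfg) : ℕ :=
  remaining N c.l (SamplerState.pos (N := N) c.var).val (c.stk SamplerStack.input).length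
    (c.stk SamplerStack.text).length (c.stk SamplerStack.read).length

theorem potential_cfg (l : Option SamplerLabel) (s : SamplerState N) (i : List Bool)
    (t : List (SampleLetter N)) (c : List Unit) (x y v : List (SampleValues N)) :
    potential (cfg P l s i t c x y v) = remaining N l s.pos.val i.length t.length y.length :=
  rfl

/-- Rewinding after every variable still costs only linear time in total: it moves back only what
the unary index moved away. The malformed cases are included because the time bound must hold for
every input. -/
theorem potential_step_lt (c : (sampler N P).Cfg) (r : Bool) (h : c.l ≠ none) :
    potential ((sampler N P).step A c r) < potential c := by
  obtain ⟨l, s, i, t, c, x, y, v, rfl⟩ := exists_eq_cfg c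
  rcases l with _ | l
  · exact absurd rfl h
  cases l with
  | draw =>
    by_cases hs : s.pos + 1 = 0
    · have hp : s.pos.val = N := by
        have h1 := congrArg Fin.val hs
        rw [Fin.val_add_one] at h1
        split_ifs at h1 with h2
        · simp [h2]
        · simp at h1
      rcases i with _ | ⟨b, _ | ⟨a, i⟩⟩
      · rw [potential_cfg, step_draw_last_nil _ _ _ _ _ _ _ hs, potential_cfg]
        simp [remaining]
      · rw [potential_cfg, step_draw_last_singleton _ _ _ _ _ _ _ hs, potential_cfg]
        simp [remaining]; omega
      · rw [potential_cfg, step_draw_last_cons _ _ _ _ _ _ _ _ hs, potential_cfg]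
        simp [remaining, SamplerState.clear]
        rw [show (N + 8) * (i.length + 1 + 1) = (N + 8) * i.length + 2 * N + 16 by ring]
        omega
    · rw [potential_cfg, step_draw _ _ _ _ _ _ _ _ hs, potential_cfg]
      have hp : (s.pos + 1).val = s.pos.val + 1 := by
        apply Fin.val_add_one_of_lt
        rw [Fin.lt_last_iff_ne_last]
        rintro h
        exact hs (by rw [h, Fin.last_add_one])
      have := (s.pos + 1).isLt
      simp [remaining]
      omega
  | count =>
    rcases t with _ | ⟨⟨_ | _, p⟩, t⟩
    · rw [potential_cfg, step_count_nil, potential_cfg]; simp [remaining]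
    · rw [potential_cfg, step_count_false, potential_cfg]; simp [remaining]
    · rw [potential_cfg, step_count_true, potential_cfg]; simp [remaining]
  | vector =>
    rcases t with _ | ⟨⟨_ | _, p⟩, t⟩
    · rw [potential_cfg, step_vector_nil, potential_cfg]; simp [remaining]
    · rw [potential_cfg, step_vector_false, potential_cfg]; simp [remaining]; omega
    · rcases t with _ | ⟨⟨a, _ | _, q⟩, t⟩
      · rw [potential_cfg, step_vector_true_nil, potential_cfg]; simp [remaining]; omega
      · rw [potential_cfg, step_vector_true_off, potential_cfg]; simp [remaining]; omega
      · rw [potential_cfg, step_vector_true_on, potential_cfg]; simp [remaining]; omega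
  | restore =>
    rcases y with _ | ⟨z, y⟩
    · rw [potential_cfg, step_restore_nil, potential_cfg]; simp [remaining]
    · rw [potential_cfg, step_restore_cons, potential_cfg]; simp [remaining]
  | token =>
    rcases t with _ | ⟨⟨_ | _, p⟩, t⟩
    · rw [potential_cfg, step_token_nil, potential_cfg]; simp [remaining]
    · rw [potential_cfg, step_token_false, potential_cfg]; simp [remaining]; omega
    · rw [potential_cfg, step_token_true, potential_cfg]; simp [remaining]; omega
  | index =>
    rcases t with _ | ⟨⟨_ | _, p⟩, t⟩
    · rw [potential_cfg, step_index_nil, potential_cfg]; simp [remaining]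
    · rw [potential_cfg, step_index_false, potential_cfg]; simp [remaining]
    · rw [potential_cfg, step_index_true, potential_cfg]; simp [remaining]; omega
  | operator =>
    rcases t with _ | ⟨⟨_ | _, p⟩, t⟩
    · rw [potential_cfg, step_operator_nil, potential_cfg]; simp [remaining]
    · rw [potential_cfg, step_operator_false, potential_cfg]; simp [remaining]; omega
    · rw [potential_cfg, step_operator_true, potential_cfg]; simp [remaining]
  | binary =>
    rw [potential_cfg, step_binary, potential_cfg]
    simp [remaining]; omega

/-- The sampling machine with `N + 1` samples runs in time `(N + 8) m + N + 6`. -/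
noncomputable def time (N : ℕ) : Polynomial ℕ :=
  Polynomial.C (N + 8) * Polynomial.X + Polynomial.C (N + 6)

theorem eval_time (m : ℕ) : (time N).eval m = (N + 8) * m + (N + 6) := by
  simp only [time, Polynomial.eval_add, Polynomial.eval_mul, Polynomial.eval_C,
    Polynomial.eval_X]

theorem runsInTime : (sampler N P).RunsInTime (time N) := by
  intro A w r hr
  refine ChoiceMachine.halts_of_potential potential potential_step_lt r _ ?_
  rw [initCfg_eq, potential_cfg, hr, eval_time]
  simp [remaining]
  omega

theorem queryFree : (sampler N P).QueryFree := fun _ => rfl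

/-! ### Correctness of the sampling machine -/

open ChoiceMachine (Reaches)

/-- The last of the `N + 1` draws is left out, because that step also consumes input. -/
theorem foldl_draw_take (q : SampleBits N) (ok : Bool) (i : List Bool) (t : List (SampleLetter N))
    (c : List Unit) (x y v : List (SampleValues N)) : ∀ (j : ℕ) (hj : j < N + 1),
    ((List.ofFn q).take j).foldl ((sampler N P).step A)
        (cfg P (some .draw) { ok := ok } i t c x y v) =
      cfg P (some .draw)
        { ok := ok, pos := ⟨j, hj⟩, bits := fun m => if m.val < j then q m else false }
        i t c x y v
  | 0, _ => by simp
  | j + 1, hj => by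
      have hlt : j < N + 1 := by omega
      have hpos : (⟨j, hlt⟩ : Fin (N + 1)) + 1 = ⟨j + 1, hj⟩ := by
        ext
        rw [Fin.val_add_one_of_lt]
        rw [Fin.lt_def]
        simp
        omega
      rw [List.take_add_one, List.foldl_append, foldl_draw_take q ok i t c x y v j hlt,
        List.getElem?_ofFn, dif_pos hlt]
      simp only [Option.toList_some, List.foldl_cons, List.foldl_nil]
      rw [step_draw _ _ _ _ _ _ _ _ (by rw [hpos]; simp [Fin.ext_iff])]
      simp only [hpos]
      congr 2
      funext m
      by_cases hm : m = ⟨j, hlt⟩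
      · subst hm; simp
      · rw [Function.update_of_ne hm]
        have : m.val ≠ j := fun h => hm (Fin.ext h)
        congr 1
        simp only [eq_iff_iff]
        omega

theorem ofFn_eq_take_append (q : SampleBits N) :
    List.ofFn q = (List.ofFn q).take N ++ [q (Fin.last N)] := by
  have h := List.take_add_one (l := List.ofFn q) (i := N)
  rw [List.take_of_length_le (by simp), List.getElem?_ofFn, dif_pos (Nat.lt_succ_self N)] at h
  exact h

theorem update_last (q : SampleBits N) (j : Fin (N + 1)) (hj : j = Fin.last N) :
    Function.update (fun m : Fin (N + 1) => if m.val < N then q m else false) j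
      (q (Fin.last N)) = q := by
  subst hj
  funext m
  by_cases hm : m = Fin.last N
  · subst hm; simp
  · rw [Function.update_of_ne hm, if_pos]
    exact Fin.lt_last_iff_ne_last.2 hm

theorem foldl_draw_cons (q : SampleBits N) (ok a b : Bool) (i : List Bool)
    (t : List (SampleLetter N)) (c : List Unit) (x y v : List (SampleValues N)) :
    (List.ofFn q).foldl ((sampler N P).step A)
        (cfg P (some .draw) { ok := ok } (b :: a :: i) t c x y v) =
      cfg P (some .draw) { ok := ok } i ((a, b, q) :: t) c x y v := by
  rw [ofFn_eq_take_append, List.foldl_append, foldl_draw_take q ok _ _ _ _ _ _ N (by omega),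
    List.foldl_cons, step_draw_last_cons _ _ _ _ _ _ _ _ (Fin.last_add_one N)]
  simp only [update_last q ⟨N, by omega⟩ rfl]
  rfl

theorem foldl_draw_nil (q : SampleBits N) (ok : Bool)
    (t : List (SampleLetter N)) (c : List Unit) (x y v : List (SampleValues N)) :
    (List.ofFn q).foldl ((sampler N P).step A)
        (cfg P (some .draw) { ok := ok } [] t c x y v) =
      cfg P (some .count) { ok := ok } [] t c x y v := by
  rw [ofFn_eq_take_append, List.foldl_append, foldl_draw_take q ok _ _ _ _ _ _ N (by omega),
    List.foldl_cons, step_draw_last_nil _ _ _ _ _ _ _ (Fin.last_add_one N)]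
  rfl

/-- Pushing onto `text` reverses the order. Applied to `L.reverse`, as in `guesser.queryWord`, this
recovers the original word. -/
theorem foldl_draw (ok : Bool) (c : List Unit) (x y v : List (SampleValues N)) :
    ∀ (L : List (Bool × Bool)) (Q : List (SampleBits N)) (t : List (SampleLetter N)),
    L.length = Q.length →
    (Q.flatMap List.ofFn).foldl ((sampler N P).step A)
        (cfg P (some .draw) { ok := ok } (L.flatMap fun p => [p.2, p.1]) t c x y v) =
      cfg P (some .draw) { ok := ok } []
        ((List.zipWith (fun p q => (p.1, p.2, q)) L Q).reverse ++ t) c x y v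
  | [], [], t, _ => rfl
  | p :: L, q :: Q, t, h => by
      rw [List.flatMap_cons, List.flatMap_cons, List.foldl_append]
      simp only [List.cons_append, List.nil_append]
      rw [foldl_draw_cons, foldl_draw ok c x y v L Q _ (by simpa using h)]
      simp

/-! ### The deterministic phases: counting, reading the vector, evaluating the expression -/

theorem exists_of_map_fst_eq_cons {α β : Type} {t : List (α × β)} {a : α} {w : List α}
    (h : t.map Prod.fst = a :: w) : ∃ p t', t = (a, p) :: t' ∧ t'.map Prod.fst = w := by
  rcases t with _ | ⟨⟨a', p⟩, t'⟩
  · simp at h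
  · simp only [List.map_cons, List.cons.injEq] at h
    exact ⟨p, t', by rw [h.1], h.2⟩

theorem reaches_vector (ok : Bool) (x y v : List (SampleValues N)) (w : List Bool) :
    ∀ (k : ℕ) (t : List (SampleLetter N)) (c : List Unit),
    t.map Prod.fst = List.replicate k true ++ false :: w →
    (sampler N P).Reaches A (cfg P (some .count) { ok := ok } [] t c x y v)
      (cfg P (some .vector) { ok := ok } [] (t.drop (k + 1)) (List.replicate k () ++ c) x y v)
  | 0, t, c, h => by
      obtain ⟨p, t, rfl, -⟩ := exists_of_map_fst_eq_cons h
      exact .head (fun _ => step_count_false _ _ _ _ _ _ _ _ _) (.refl _)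
  | k + 1, t, c, h => by
      rw [List.replicate_succ, List.cons_append] at h
      obtain ⟨p, t, rfl, h'⟩ := exists_of_map_fst_eq_cons h
      refine .head (fun _ => step_count_true _ _ _ _ _ _ _ _ _) ?_
      have := reaches_vector ok x y v w k t (() :: c) h'
      rwa [show List.replicate k () ++ () :: c = List.replicate (k + 1) () ++ c by
        rw [List.replicate_succ']; simp] at this

/-- The first `n` entries at odd positions. -/
def oddEntries {α : Type} : ℕ → List α → List α
  | n + 1, _ :: a :: l => a :: oddEntries n l
  | _, _ => []

theorem oddEntries_eq_ofFn {α : Type} : ∀ (n : ℕ) (l : List α) (h : 2 * n ≤ l.length),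
    oddEntries n l = List.ofFn fun i : Fin n => l[2 * i.val + 1]'(by omega)
  | 0, l, _ => by simp [oddEntries]
  | n + 1, [], h => by simp at h
  | n + 1, [a], h => by simp at h; omega
  | n + 1, a :: b :: l, h => by
      rw [oddEntries, oddEntries_eq_ofFn n l (by simp at h; omega), List.ofFn_succ]
      simp [Nat.mul_add]

theorem length_flatMap_true (e : List Bool) :
    (e.flatMap fun b => [true, b]).length = 2 * e.length := by
  induction e with
  | nil => rfl
  | cons b e ih => rw [List.flatMap_cons, List.length_append, ih, List.length_cons]; simp; ring

theorem isSome_head?_and_decide {α : Type} (ok : Bool) (c : List α) (m : ℕ) :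
    (ok && c.head?.isSome && decide (m ≤ c.tail.length)) = (ok && decide (m + 1 ≤ c.length)) := by
  cases c with
  | nil => simp
  | cons a c =>
    simp only [List.head?_cons, Option.isSome_some, Bool.and_true, List.tail_cons,
      List.length_cons]
    congr 1
    exact decide_eq_decide.2 (by omega)

/-- Induction over the entries, with flag and counter kept general: the flag survives exactly when
the annotated entries do not outnumber the counter symbols. `isSome_head?_and_decide` is the
bookkeeping for one pop. -/
theorem reaches_restore (x v : List (SampleValues N)) (w : List Bool) :
    ∀ (e : List Bool) (ok : Bool) (t : List (SampleLetter N)) (c : List Unit)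
      (y : List (SampleValues N)),
    t.map Prod.fst = (e.flatMap fun b => [true, b]) ++ false :: w →
    (sampler N P).Reaches A (cfg P (some .vector) { ok := ok } [] t c x y v)
      (cfg P (some .restore)
        { ok := ok && decide ((oddEntries e.length t).countP (fun p => p.2.1) ≤ c.length) } []
        (t.drop (2 * e.length + 1)) (c.drop ((oddEntries e.length t).countP fun p => p.2.1)) x
        (((oddEntries e.length t).map SampleLetter.values).reverse ++ y) v)
  | [], ok, t, c, y, h => by
      obtain ⟨p, t, rfl, -⟩ := exists_of_map_fst_eq_cons h
      refine .head (fun _ => step_vector_false _ _ _ _ _ _ _ _ _) ?_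
      simp only [List.length_nil, oddEntries, List.countP_nil, Nat.zero_le, decide_true,
        Bool.and_true, List.drop_zero, List.map_nil, List.reverse_nil, List.nil_append]
      exact .refl _
  | a :: e, ok, t, c, y, h => by
      rw [List.flatMap_cons] at h
      simp only [List.cons_append, List.nil_append] at h
      obtain ⟨p, t, rfl, h'⟩ := exists_of_map_fst_eq_cons h
      obtain ⟨⟨_ | _, q⟩, t, rfl, h''⟩ := exists_of_map_fst_eq_cons h'
      · refine .head (fun _ => step_vector_true_off _ _ _ _ _ _ _ _ _ _ _) ?_
        have := reaches_restore x v w e ok t c (SampleLetter.values (a, false, q) :: y) h''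
        simpa [oddEntries, Nat.mul_add, SamplerState.clear] using this
      · refine .head (fun _ => step_vector_true_on _ _ _ _ _ _ _ _ _ _ _) ?_
        have := reaches_restore x v w e (ok && c.head?.isSome) t c.tail
          (SampleLetter.values (a, true, q) :: y) h''
        rw [isSome_head?_and_decide, List.drop_tail] at this
        simpa [oddEntries, Nat.mul_add] using this

theorem reaches_token (ok : Bool) (t : List (SampleLetter N)) (c : List Unit)
    (v : List (SampleValues N)) : ∀ x y : List (SampleValues N),
    (sampler N P).Reaches A (cfg P (some .restore) { ok := ok } [] t c x y v)
      (cfg P (some .token) { ok := ok } [] t c (y.reverse ++ x) [] v)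
  | x, [] => .head (fun _ => step_restore_nil _ _ _ _ _ _ _) (.refl _)
  | x, z :: y => by
      refine .head (fun _ => step_restore_cons _ _ _ _ _ _ _ _ _) ?_
      have := reaches_token ok t c v (z :: x) y
      rw [List.reverse_cons, List.append_assoc]
      exact this

/-- A unary index `j` shifts `j` symbols from `unread` to `read`, which brings the wanted variable
to the top. The shifted symbols lie reversed, as the rewinding phase expects. -/
theorem reaches_restore_index (ok : Bool) (c : List Unit) (v : List (SampleValues N))
    (w : List Bool) (z : SampleValues N) :
    ∀ (j : ℕ) (t : List (SampleLetter N)) (x y : List (SampleValues N)),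
    t.map Prod.fst = List.replicate j true ++ false :: w → x[j]? = some z →
    ∃ t' : List (SampleLetter N), t'.map Prod.fst = w ∧
      (sampler N P).Reaches A (cfg P (some .index) { ok := ok } [] t c x y v)
        (cfg P (some .restore) { ok := ok } [] t' c (x.drop j) ((x.take j).reverse ++ y) (z :: v))
  | 0, t, x, y, h, hz => by
      obtain ⟨p, t, rfl, h'⟩ := exists_of_map_fst_eq_cons h
      refine ⟨t, h', .head (fun _ => step_index_false _ _ _ _ _ _ _ _ _) ?_⟩
      rw [← List.head?_eq_getElem?] at hz
      rw [hz]
      exact .refl _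
  | j + 1, t, x, y, h, hz => by
      rw [List.replicate_succ, List.cons_append] at h
      obtain ⟨p, t, rfl, h'⟩ := exists_of_map_fst_eq_cons h
      rcases x with _ | ⟨a, x⟩
      · simp at hz
      obtain ⟨t', ht', hr⟩ := reaches_restore_index ok c v w z j t x (a :: y) h' (by simpa using hz)
      refine ⟨t', ht', .head (fun _ => step_index_true _ _ _ _ _ _ _ _ _) ?_⟩
      simpa [SamplerState.clear] using hr

/-- The stack invariant of reverse Polish evaluation, for all assignments `fun i => e i o` at once.
The remaining text `w` and the lower stack `v` are arbitrary so that the induction applies to both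
operands in turn. -/
theorem reaches_eval {d : ℕ} (ok : Bool) (c : List Unit) (e : Fin d → SampleValues N)
    (φ : BoolFormula d) : ∀ (w : List Bool) (t : List (SampleLetter N))
      (v : List (SampleValues N)), t.map Prod.fst = φ.encode ++ w →
    ∃ t' : List (SampleLetter N), t'.map Prod.fst = w ∧
      (sampler N P).Reaches A (cfg P (some .token) { ok := ok } [] t c (List.ofFn e) [] v)
        (cfg P (some .token) { ok := ok } [] t' c (List.ofFn e) []
          ((fun o => φ.eval fun i => e i o) :: v)) := by
  induction φ with
  | var j =>
    intro w t v h
    simp only [BoolFormula.encode, BoolFormula.tokens, FormulaToken.bits, List.flatMap_cons,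
      List.flatMap_nil, List.append_nil, List.cons_append, List.append_assoc,
      List.nil_append] at h
    obtain ⟨p, t, rfl, h'⟩ := exists_of_map_fst_eq_cons h
    obtain ⟨t', ht', hr⟩ := reaches_restore_index (P := P) (A := A) ok c v w (e j) j t
      (List.ofFn e) [] h' (by simp)
    refine ⟨t', ht', .head (fun _ => step_token_false _ _ _ _ _ _ _ _ _) (hr.trans ?_)⟩
    have := reaches_token (P := P) (A := A) ok t' c (e j :: v) ((List.ofFn e).drop j)
      (((List.ofFn e).take j).reverse ++ [])
    rw [List.append_nil, List.reverse_reverse, List.take_append_drop] at this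
    rw [List.append_nil]
    exact this
  | neg φ ih =>
    intro w t v h
    simp only [BoolFormula.encode, BoolFormula.tokens, FormulaToken.bits, List.flatMap_append,
      List.flatMap_cons, List.flatMap_nil, List.append_nil, List.append_assoc, List.cons_append,
      List.nil_append] at h
    obtain ⟨t, ht, hr⟩ := ih _ t v h
    obtain ⟨p, t, rfl, ht'⟩ := exists_of_map_fst_eq_cons ht
    obtain ⟨p', t, rfl, ht''⟩ := exists_of_map_fst_eq_cons ht'
    refine ⟨t, ht'', hr.trans ?_⟩
    refine .head (fun _ => step_token_true _ _ _ _ _ _ _ _ _) ?_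
    exact .head (fun _ => step_operator_false _ _ _ _ _ _ _ _ _) (.refl _)
  | conj φ ψ ih₁ ih₂ =>
    intro w t v h
    simp only [BoolFormula.encode, BoolFormula.tokens, FormulaToken.bits, List.flatMap_append,
      List.flatMap_cons, List.flatMap_nil, List.append_nil, List.append_assoc, List.cons_append,
      List.nil_append] at h
    obtain ⟨t, ht, hr₁⟩ := ih₁ _ t v h
    obtain ⟨t, ht, hr₂⟩ := ih₂ _ t _ ht
    obtain ⟨p, t, rfl, ht'⟩ := exists_of_map_fst_eq_cons ht
    obtain ⟨p', t, rfl, ht''⟩ := exists_of_map_fst_eq_cons ht'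
    obtain ⟨p'', t, rfl, ht'''⟩ := exists_of_map_fst_eq_cons ht''
    refine ⟨t, ht''', hr₁.trans (hr₂.trans ?_)⟩
    refine .head (fun _ => step_token_true _ _ _ _ _ _ _ _ _) ?_
    refine .head (fun _ => step_operator_true _ _ _ _ _ _ _ _ _) ?_
    exact .head (fun _ => step_binary _ _ _ _ _ _ _ _) (.refl _)
  | disj φ ψ ih₁ ih₂ =>
    intro w t v h
    simp only [BoolFormula.encode, BoolFormula.tokens, FormulaToken.bits, List.flatMap_append,
      List.flatMap_cons, List.flatMap_nil, List.append_nil, List.append_assoc, List.cons_append,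
      List.nil_append] at h
    obtain ⟨t, ht, hr₁⟩ := ih₁ _ t v h
    obtain ⟨t, ht, hr₂⟩ := ih₂ _ t _ ht
    obtain ⟨p, t, rfl, ht'⟩ := exists_of_map_fst_eq_cons ht
    obtain ⟨p', t, rfl, ht''⟩ := exists_of_map_fst_eq_cons ht'
    obtain ⟨p'', t, rfl, ht'''⟩ := exists_of_map_fst_eq_cons ht''
    refine ⟨t, ht''', hr₁.trans (hr₂.trans ?_)⟩
    refine .head (fun _ => step_token_true _ _ _ _ _ _ _ _ _) ?_
    refine .head (fun _ => step_operator_true _ _ _ _ _ _ _ _ _) ?_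
    exact .head (fun _ => step_binary _ _ _ _ _ _ _ _) (.refl _)

/-- Concatenates the phases. Only the letters that hold entries of `x` enter through `e`;
annotations and random bits elsewhere are ignored. -/
theorem reaches_result (I : RelevantInputInstance) (t : List (SampleLetter N))
    (ht : t.map Prod.fst = I.encode) (e : Fin I.d → SampleLetter N)
    (he : ∀ i : Fin I.d, t[I.k + 1 + (2 * i.val + 1)]? = some (e i)) :
    ∃ c x y v, (sampler N P).Reaches A (cfg P (some .count) { ok := true } [] t [] [] [] [])
      (cfg P none
        { ok := decide ((Finset.univ.filter fun i => (e i).2.1 = true).card ≤ I.k) &&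
            P fun o => I.Φ.eval fun i => (e i).values o } [] [] c x y v) := by
  simp only [RelevantInputInstance.encode, List.append_assoc, List.cons_append,
    List.nil_append] at ht
  have h₁ := reaches_vector (P := P) (A := A) true [] [] [] _ I.k t [] ht
  rw [List.append_nil] at h₁
  have ht₁ : (t.drop (I.k + 1)).map Prod.fst =
      ((List.ofFn I.x).flatMap fun b => [true, b]) ++ false :: I.Φ.encode := by
    rw [List.map_drop, ht, ← List.singleton_append, ← List.append_assoc,
      List.drop_left' (by simp)]
  have hodd : oddEntries (List.ofFn I.x).length (t.drop (I.k + 1)) = List.ofFn e := by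
    have hlen := congrArg List.length ht₁
    rw [List.length_map, List.length_append, length_flatMap_true, List.length_ofFn,
      List.length_drop] at hlen
    rw [List.length_ofFn, oddEntries_eq_ofFn _ _ (by rw [List.length_drop]; omega)]
    congr 1
    funext i
    have := he i
    rw [List.getElem_drop]
    exact Option.some_injective _ (by rw [← this, List.getElem?_eq_getElem])
  have h₂ := reaches_restore (P := P) (A := A) [] [] _ _ true _ (List.replicate I.k ()) [] ht₁
  rw [hodd, Bool.true_and, List.length_replicate, List.append_nil] at h₂
  have hcount : (List.ofFn e).countP (fun p => p.2.1) =
      (Finset.univ.filter fun i => (e i).2.1 = true).card := by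
    rw [List.countP_eq_length_filter, List.ofFn_eq_map, List.filter_map, List.length_map,
      ← List.toFinset_card_of_nodup ((List.nodup_finRange _).filter _)]
    congr 1
    ext
    simp
  rw [hcount, List.map_ofFn] at h₂
  set ok := decide ((Finset.univ.filter fun i => (e i).2.1 = true).card ≤ I.k) with hok
  have h₃ := reaches_token (P := P) (A := A) ok
    ((t.drop (I.k + 1)).drop (2 * (List.ofFn I.x).length + 1))
    ((List.replicate I.k ()).drop (Finset.univ.filter fun i => (e i).2.1 = true).card) [] []
    ((List.ofFn e).map SampleLetter.values).reverse
  rw [List.reverse_reverse, List.append_nil, List.map_ofFn] at h₃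
  have ht₂ : ((t.drop (I.k + 1)).drop (2 * (List.ofFn I.x).length + 1)).map Prod.fst =
      I.Φ.encode ++ [] := by
    rw [List.map_drop, ht₁, ← List.singleton_append, ← List.append_assoc,
      List.drop_left' (by rw [List.length_append, length_flatMap_true]; rfl),
      List.append_nil]
  obtain ⟨t', ht', h₄⟩ := reaches_eval (P := P) (A := A) ok
    ((List.replicate I.k ()).drop (Finset.univ.filter fun i => (e i).2.1 = true).card)
    (SampleLetter.values ∘ e) I.Φ [] _ [] ht₂
  obtain rfl := List.map_eq_nil_iff.1 ht'
  have h₅ := h₁.trans (h₂.trans (h₃.trans h₄))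
  exact ⟨_, _, _, _, h₅.trans (.head (fun _ => step_token_nil _ _ _ _ _ _ _) (.refl _))⟩

/-! ### Acceptance probabilities -/

theorem getElem?_flatMap_true : ∀ (e : List Bool) (i : ℕ),
    (e.flatMap fun b => [true, b])[2 * i + 1]? = e[i]?
  | [], i => by simp
  | b :: e, 0 => by simp
  | b :: e, i + 1 => by
      rw [List.flatMap_cons, List.getElem?_append_right (by simp; omega)]
      have := getElem?_flatMap_true e i
      rw [List.getElem?_cons_succ, ← this]
      congr 1

/-- The position of the entry `x i` in the description of an instance. -/
def position (I : RelevantInputInstance) (i : Fin I.d) : ℕ := I.k + 1 + (2 * i.val + 1)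

theorem getElem?_encode (I : RelevantInputInstance) (i : Fin I.d) :
    I.encode[position I i]? = some (I.x i) := by
  have h2 : 2 * i.val + 1 < ((List.ofFn I.x).flatMap fun b => [true, b]).length := by
    rw [length_flatMap_true, List.length_ofFn]
    omega
  rw [RelevantInputInstance.encode, List.append_assoc, List.getElem?_append_right
    (by simp [position]), List.append_assoc, List.getElem?_append_left]
  · simp only [position, List.length_append, List.length_replicate, List.length_singleton,
      Nat.add_sub_cancel_left]
    rw [getElem?_flatMap_true]
    simp
  · simpa [position] using h2

theorem position_lt (I : RelevantInputInstance) (i : Fin I.d) : position I i < I.encode.length := by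
  by_contra h
  have := getElem?_encode I i
  rw [List.getElem?_eq_none (by omega)] at this
  simp at this

theorem position_injective (I : RelevantInputInstance) : Function.Injective (position I) := by
  intro i j h
  ext
  simp only [position] at h
  omega

/-- The set that is described by an annotated instance. -/
def annotatedSet (I : RelevantInputInstance) (L : List (Bool × Bool)) : Finset (Fin I.d) :=
  Finset.univ.filter fun i => ((L.map Prod.snd)[position I i]?).getD false = true

/-- Mark exactly the positions of the elements of `S`; injectivity of `position` prevents other
indices from being marked. -/
theorem exists_annotation (I : RelevantInputInstance) (S : Finset (Fin I.d)) :
    ∃ L : List (Bool × Bool), L.map Prod.fst = I.encode ∧ annotatedSet I L = S := by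
  classical
  have hlen : ((List.range I.encode.length).map fun p =>
    decide (∃ i ∈ S, p = position I i)).length = I.encode.length := by simp
  refine ⟨I.encode.zip ((List.range I.encode.length).map fun p =>
    decide (∃ i ∈ S, p = position I i)), List.map_fst_zip hlen.ge, ?_⟩
  ext i
  rw [annotatedSet, List.map_snd_zip hlen.le, Finset.mem_filter]
  simp only [List.getElem?_map, List.getElem?_range (position_lt I i), Option.map_some,
    Option.getD_some, Finset.mem_univ, true_and, decide_eq_true_eq]
  constructor
  · rintro ⟨j, hj, h⟩
    rwa [position_injective I h]
  · exact fun h => ⟨i, h, rfl⟩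

/-! ### From choice bits to uniform samples -/

/-- Among sufficiently many choice bits for an input with `m` letters, the index of the `j`-th
random bit that is attached to the letter at position `p`. -/
def bitIndex {T : ℕ} (N m p : ℕ) (hT : (m + 1) * (N + 1) ≤ T) (j : Fin (N + 1)) : Fin T :=
  -- The word is read backwards, so the letter at position `p` is served after `m - 1 - p` others.
  ⟨(m - 1 - p) * (N + 1) + j, by
    have h1 : (m - 1 - p) * (N + 1) ≤ m * (N + 1) := Nat.mul_le_mul_right _ (by omega)
    have h2 := j.isLt
    have h3 : (m + 1) * (N + 1) = m * (N + 1) + (N + 1) := by ring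
    omega⟩

/-- The choice bits are cut into blocks of `N + 1`: one per letter, plus one spent before the empty
input is noticed. The leftover bits `r'` drive the deterministic phases and have no influence. -/
theorem foldl_draw_ofFn {T : ℕ} (L : List (Bool × Bool)) (hT : (L.length + 1) * (N + 1) ≤ T)
    (r : Fin T → Bool) : ∃ (r' : List Bool) (t : List (SampleLetter N)),
    (List.ofFn r).foldl ((sampler N P).step A) ((sampler N P).initCfg (guesser.queryWord L)) =
      r'.foldl ((sampler N P).step A) (cfg P (some .count) { ok := true } [] t [] [] [] []) ∧
    t.map Prod.fst = L.map Prod.fst ∧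
    ∀ p (hp : p < L.length), t[p]? =
      some (L[p].1, L[p].2, fun j => r (bitIndex N L.length p hT j)) := by
  obtain ⟨R, rfl⟩ := Nat.exists_eq_add_of_le hT
  have hr : ∀ (q : Fin (L.length + 1)) (j : Fin (N + 1)),
      q.val * (N + 1) + j.val < (L.length + 1) * (N + 1) + R := by
    intro q j
    have h1 : q.val * (N + 1) ≤ L.length * (N + 1) := Nat.mul_le_mul_right _ (by omega)
    have h2 := j.isLt
    have h3 : (L.length + 1) * (N + 1) = L.length * (N + 1) + (N + 1) := by ring
    omega
  let B : Fin (L.length + 1) → SampleBits N := fun q j => r ⟨q.val * (N + 1) + j.val, hr q j⟩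
  let Q : List (SampleBits N) := List.ofFn fun q : Fin L.length => B q.castSucc
  have hQ : Q.length = L.length := by simp [Q]
  have hsplit : List.ofFn r = Q.flatMap List.ofFn ++ (List.ofFn (B (Fin.last _)) ++
      List.ofFn fun i : Fin R => r (Fin.natAdd _ i)) := by
    rw [List.ofFn_add, List.ofFn_mul, List.ofFn_succ', List.concat_eq_append, List.flatten_append,
      List.append_assoc]
    congr 1
    · rw [List.flatMap_def, List.map_ofFn]
      rfl
    · rw [List.flatten_singleton]
      rfl
  refine ⟨List.ofFn fun i : Fin R => r (Fin.natAdd _ i),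
    (List.zipWith (fun p q => (p.1, p.2, q)) L.reverse Q).reverse, ?_, ?_, ?_⟩
  · rw [hsplit, initCfg_eq, guesser.queryWord, List.foldl_append,
      foldl_draw true [] [] [] [] L.reverse Q [] (by simp [hQ]), List.foldl_append,
      foldl_draw_nil, List.append_nil]
  · rw [List.map_reverse, List.reverse_eq_iff, List.map_zipWith, ← List.map_reverse]
    refine List.ext_getElem (by simp [hQ]) fun i h1 h2 => ?_
    simp
  · intro p hp
    rw [List.getElem?_eq_getElem (by simpa [hQ] using hp)]
    simp only [List.getElem_reverse, List.getElem_zipWith, List.length_zipWith,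
      List.length_reverse, hQ, min_self, Option.some.injEq, Prod.mk.injEq]
    have hidx : L.length - 1 - (L.length - 1 - p) = p := by omega
    simp only [hidx, true_and]
    simp [Q, B, bitIndex]

theorem le_eval_time (L : List (Bool × Bool)) :
    (L.length + 1) * (N + 1) ≤ (time N).eval (guesser.queryWord L).length := by
  rw [eval_time, guesser.length_queryWord]
  nlinarith

/-- The random completions that are given by the choice bits `r`. -/
def samples (I : RelevantInputInstance) (S : Finset (Fin I.d)) {T : ℕ} (N m : ℕ)
    (hT : (m + 1) * (N + 1) ≤ T) (r : Fin T → Bool) : Fin (N + 1) → {i // i ∉ S} → Bool :=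
  fun j i => r (bitIndex N m (position I i) hT j)

/-- Different pairs of sample and coordinate use different choice bits: the remainder of the index
modulo `N + 1` is the sample, the quotient gives the position. -/
theorem unifProb_samples (I : RelevantInputInstance) (S : Finset (Fin I.d)) {T m : ℕ}
    (hT : (m + 1) * (N + 1) ≤ T) (hm : I.encode.length = m)
    (E : (Fin (N + 1) → {i // i ∉ S} → Bool) → Prop) :
    unifProb (fun r : Fin T → Bool => E (samples I S N m hT r)) = unifProb E := by
  rw [← unifProb_comp_equiv (Equiv.curry (Fin (N + 1)) {i // i ∉ S} Bool) E,
    ← unifProb_comp_injective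
      (fun ji : Fin (N + 1) × {i // i ∉ S} => bitIndex N m (position I ji.2) hT ji.1)]
  · rfl
  · rintro ⟨j, i⟩ ⟨j', i'⟩ h
    have h1 := position_lt I i
    have h2 := position_lt I i'
    have h := congrArg Fin.val h
    simp only [bitIndex] at h
    have hj : j.val = j'.val := by
      have := congrArg (· % (N + 1)) h
      simpa [Nat.mul_add_mod', Nat.mod_eq_of_lt j.isLt, Nat.mod_eq_of_lt j'.isLt] using this
    rw [hj] at h
    have hp := Nat.eq_of_mul_eq_mul_right (Nat.succ_pos N) (Nat.add_right_cancel h)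
    -- Both positions are less than `m`, so the truncated subtractions can be cancelled.
    have := position_injective I (show position I i = position I i' by omega)
    exact Prod.ext (Fin.ext hj) (Subtype.ext this)

/-- Choices matter only while random bits are drawn. From then on `reaches_result` fixes the halted
configuration, and the time bound ensures that the run has arrived there. -/
theorem accepts_iff (I : RelevantInputInstance) (L : List (Bool × Bool))
    (hL : L.map Prod.fst = I.encode)
    (r : Fin ((time N).eval (guesser.queryWord L).length) → Bool) :
    (sampler N P).Accepts A (guesser.queryWord L) (List.ofFn r) ↔
      (annotatedSet I L).card ≤ I.k ∧
        P (fun o => I.Φ.eval (o.elim I.x fun j => completion I.x (annotatedSet I L)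
          (samples I (annotatedSet I L) N L.length (le_eval_time L) r j))) = true := by
  have hlen : I.encode.length = L.length := by rw [← hL, List.length_map]
  have hpos : ∀ i, position I i < L.length := fun i => hlen ▸ position_lt I i
  obtain ⟨r', t, hrun, ht, hte⟩ := foldl_draw_ofFn (P := P) (A := A) L (le_eval_time L) r
  have hx : ∀ i, (L[position I i]'(hpos i)).1 = I.x i := by
    intro i
    have h := getElem?_encode I i
    rw [← hL, List.getElem?_map, List.getElem?_eq_getElem (hpos i)] at h
    simpa using h
  have hS : ∀ i, i ∈ annotatedSet I L ↔ (L[position I i]'(hpos i)).2 = true := by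
    intro i
    rw [annotatedSet, Finset.mem_filter, List.getElem?_map, List.getElem?_eq_getElem (hpos i)]
    simp
  obtain ⟨c, x, y, v, hreach⟩ := reaches_result (P := P) (A := A) I t (ht.trans hL)
    (fun i => ((L[position I i]'(hpos i)).1, (L[position I i]'(hpos i)).2,
      fun j => r (bitIndex N L.length (position I i) (le_eval_time L) j)))
    (fun i => hte _ (hpos i))
  have hhalt := runsInTime (P := P) A (guesser.queryWord L) (List.ofFn r) (by simp)
  rw [ChoiceMachine.run, hrun] at hhalt
  have hfinal := hreach.foldl_eq rfl hhalt
  have hval : (fun o : Option (Fin (N + 1)) => I.Φ.eval fun i =>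
      SampleLetter.values ((L[position I i]'(hpos i)).1, (L[position I i]'(hpos i)).2,
        fun j => r (bitIndex N L.length (position I i) (le_eval_time L) j)) o) =
      fun o => I.Φ.eval (o.elim I.x fun j => completion I.x (annotatedSet I L)
        (samples I (annotatedSet I L) N L.length (le_eval_time L) r j)) := by
    funext o
    congr 1
    funext i
    rcases o with _ | j
    · exact hx i
    · simp only [SampleLetter.values, Option.elim_some, completion, hS, hx]
      by_cases h : (L[position I i]'(hpos i)).2 = true
      · simp [h]
      · simp [h, samples]
  have hset : (Finset.univ.filter fun i => (L[position I i]'(hpos i)).2 = true) =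
      annotatedSet I L := by
    ext i
    simp [hS]
  rw [ChoiceMachine.Accepts, ChoiceMachine.run, hrun, hfinal]
  simp only [hval, hset]
  change (none : Option SamplerLabel) = none ∧ (decide _ && _) = true ↔ _
  simp

/-! ### The bounded-error problem and its acceptance probabilities -/

/-- The test whether at least the fraction `θ` of the samples has the same value as the given
vector. -/
noncomputable def fractionTest (θ : ℝ) (N : ℕ) (u : SampleValues N) : Bool :=
  decide (θ ≤ ((Finset.univ.filter fun j => u (some j) = u none).card : ℝ) / ((N + 1 : ℕ) : ℝ))

/-- The promise that the sampling machine has bounded error. -/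
noncomputable def problem (N : ℕ) (P : SampleValues N → Bool) : PromiseProblem where
  yes := {w | 2 / 3 ≤ unifProb fun r : Fin ((time N).eval w.length) → Bool =>
    (sampler N P).Accepts 0 w (List.ofFn r)}
  no := {w | unifProb (fun r : Fin ((time N).eval w.length) → Bool =>
    (sampler N P).Accepts 0 w (List.ofFn r)) ≤ 1 / 3}
  disj w h₁ h₂ := by
    have h₁ : (2 : ℝ) / 3 ≤ _ := h₁
    have h₂ : _ ≤ (1 : ℝ) / 3 := h₂
    linarith

theorem problem_mem_BPP : problem N P ∈ BPP :=
  ⟨sampler N P, time N, queryFree, runsInTime, fun _ h => h, fun _ h => h⟩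

theorem unifProb_accepts (θ : ℝ) (I : RelevantInputInstance) (L : List (Bool × Bool))
    (hL : L.map Prod.fst = I.encode) (hS : (annotatedSet I L).card ≤ I.k) :
    unifProb (fun r : Fin ((time N).eval (guesser.queryWord L).length) → Bool =>
        (sampler N (fractionTest θ N)).Accepts A (guesser.queryWord L) (List.ofFn r)) =
      unifProb fun b : Fin (N + 1) → {i // i ∉ annotatedSet I L} → Bool =>
        θ ≤ sampleMean I.Φ.eval I.x (annotatedSet I L) b := by
  rw [← unifProb_samples I (annotatedSet I L) (le_eval_time L) (by rw [← hL, List.length_map])]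
  refine unifProb_congr fun r => ?_
  rw [accepts_iff I L hL]
  simp only [hS, true_and, fractionTest, sampleMean, Option.elim_some, Option.elim_none]
  exact decide_eq_true_iff

theorem unifProb_accepts_eq_zero (I : RelevantInputInstance) (L : List (Bool × Bool))
    (hL : L.map Prod.fst = I.encode) (hS : ¬ (annotatedSet I L).card ≤ I.k) :
    unifProb (fun r : Fin ((time N).eval (guesser.queryWord L).length) → Bool =>
        (sampler N P).Accepts A (guesser.queryWord L) (List.ofFn r)) = 0 := by
  rw [← unifProb_false (α := Fin ((time N).eval (guesser.queryWord L).length) → Bool)]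
  refine unifProb_congr fun r => ?_
  rw [accepts_iff I L hL]
  simp [hS]

end sampler

theorem gappedRelevantInput_mem_NPRel_BPP (δ γ : ℝ) (hγ : 0 < γ) :
    GappedRelevantInput δ γ hγ.le ∈ NPRel BPP := by
  -- The machine takes `N + 1` samples, so the positive sample size is written as a successor.
  obtain ⟨N, hN⟩ := Nat.exists_eq_succ_of_ne_zero (exp_neg_sample_size_le hγ).1.ne'
  refine mem_NPRel_of_annotation
    (Q := sampler.problem N (sampler.fractionTest (δ - γ / 2) N)) sampler.problem_mem_BPP ?_ ?_
  · rintro w ⟨I, rfl, S, hS, hrel⟩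
    obtain ⟨L, hL, rfl⟩ := sampler.exists_annotation I S
    refine ⟨L, hL, ?_⟩
    have h := sampleMean_ge_of_isRelevant hγ hrel
    rw [hN] at h
    change (2 : ℝ) / 3 ≤ _
    rw [sampler.unifProb_accepts _ I L hL hS]
    exact h
  · rintro w ⟨I, rfl, hno⟩ L hL
    change _ ≤ (1 : ℝ) / 3
    -- The guess is unrestricted, so oversized sets must be handled here: they are never accepted.
    by_cases hS : (sampler.annotatedSet I L).card ≤ I.k
    · have h := sampleMean_lt_of_not_isRelevant hγ (fun hrel => hno ⟨_, hS, hrel⟩)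
      rw [hN] at h
      rw [sampler.unifProb_accepts _ I L hL hS]
      have h' := unifProb_not fun b : Fin (N + 1) → {i // i ∉ sampler.annotatedSet I L} → Bool =>
        δ - γ / 2 ≤ sampleMean I.Φ.eval I.x (sampler.annotatedSet I L) b
      simp only [not_le] at h'
      rw [h'] at h
      linarith
    · rw [sampler.unifProb_accepts_eq_zero I L hL hS]
      norm_num

theorem mainTheorem3 (δ γ : ℝ) (hδ₀ : 0 < δ) (hδ₁ : δ < 1) (hγ₀ : 0 < γ) (hγδ : γ < δ) :
    GappedRelevantInput δ γ hγ₀.le ∈ NPRel BPP ∧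
    ∀ (d : ℕ) (Φ : (Fin d → Bool) → Bool) (x : Fin d → Bool) (S : Finset (Fin d)),
      (IsRelevant δ Φ x S → 2 / 3 ≤
        unifProb fun b : Fin ⌈2 * Real.log 3 / γ ^ 2⌉₊ → {i // i ∉ S} → Bool =>
          δ - γ / 2 ≤ sampleMean Φ x S b) ∧
      (¬ IsRelevant (δ - γ) Φ x S → 2 / 3 ≤
        unifProb fun b : Fin ⌈2 * Real.log 3 / γ ^ 2⌉₊ → {i // i ∉ S} → Bool =>
          sampleMean Φ x S b < δ - γ / 2) :=
  ⟨gappedRelevantInput_mem_NPRel_BPP δ γ hγ₀, fun _ _ _ _ =>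
    ⟨sampleMean_ge_of_isRelevant hγ₀, sampleMean_lt_of_not_isRelevant hγ₀⟩⟩
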